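/- **Conventions.** A twisted Coxeter system $(W,S,*)$ is a Coxeter system $(W,S)$ with an automorphism $*$ of $W$ such that $**=\mathrm{id}$ and $S^*=S$; here $S$ is always finite and totally ordered. Let $m(s,t)\in\{1,2,\dots\}\cup\{\infty\}$ be the order of $st$, and for $J\subseteq K\subseteq S$ let $\partial_K J$ be the set of $s\in K-J$ with $m(s,t)>2$ for some $t\in J$; write $\partial J=\partial_S J$. Let $V$ be the real vector space with basis $\{\alpha_s\}_{s\in S}$ and form $(\alpha_s,\alpha_t)=-\cos(\pi/m(s,t))$ (so $-1$ if $m(s,t)=\infty$), on which $s\in S$ acts by $sv=v-2(\alpha_s,v)\alpha_s$; let $V_J=\mathrm{span}\{\alpha_s:s\in J\}$ and $\mathbb R[S]=\mathbb R[x_s:s\in S]$; extend form and action to $V\otimes\mathbb R[S]$. For $\alpha\in V$ write $\alpha\ge0$ ($\alpha\leq 0$) if all coordinates are $\geq 0$ ($\le0$), and $\alpha>0$ ($\alpha<0$) if also $\alpha\ne0$. Let $\circ$ be the Demazure product ($w\circ s=ws$ if $\ell(ws)>\ell(w)$ and $w\circ s=w$ otherwise). For $z\in\mathcal I_*=\{w:w^*=w^{-1}\}$,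 $\hat{\mathcal R}_*(z)$ is the set of words $(s_1,\dots,s_n)$ of minimal length with $z=s_n^*\circ\cdots\circ s_1^*\circ s_1\circ\cdots\circ s_n$. For words $\mathbf a,\mathbf b$, "$(\mathbf a,—)\sim(\mathbf b,—)$" is the symmetric relation $\mathbf a\mathbf c\sim\mathbf b\mathbf c$ for all words $\mathbf c$. A *generalized half-braid relation* is one of the form $(r_1,\dots,r_k,s,t,s,\dots,—)\sim(r_1,\dots,r_k,t,s,t,\dots,—)$ with $s\neq t$ and the same number $\geq 1$ of alternating terms on both sides, where both displayed words lie in $\hat{\mathcal R}_*(z)$ for a common $z\in\mathcal I_*$. For a bijection $\theta$ of $\{s,t\}$ put $m_\theta(s,t)=\frac{m+1}2,\ \frac m2+1,\ \frac m2,\ \infty$ according as $m=m(s,t)$ is odd, is even with $\theta=\mathrm{id}$, is even with $\theta\ne\mathrm{id}$, is $\infty$. **Braid systems.** A braid system $\mathcal B=(\{\mathbf s,\mathbf t\},\sigma,C)$ with domain $J\subseteq S$ consists of two words of equal length, a linear map $\sigma:V_J\to V\otimes\mathbb R[S]$, and a set $C$ of constraints on elements of $\mathbb R[S]$. It is *constant*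 if $\sigma V_J\subseteq V$ and $C=\varnothing$. A *solution* is a ring homomorphism $\psi:\mathbb R[S]\to\mathbb R$ making all constraints true and such that $(1\otimes\psi)\sigma\alpha_s$ is $>0$ or $<0$ for every $s\in J$. The system is *valid* if both words are reduced and it has a solution. If $r,s\in J$ and $\theta$ is a bijection of $\{r,s\}$ with $\sigma\alpha_r=\alpha_{\theta(r)^*}$, $\sigma\alpha_s=\alpha_{\theta(s)^*}$ and $n:=m_\theta(r,s)<m(r,s)<\infty$, then for each $u\in J$ the relation $(\underbrace{r,s,r,\dots}_{n},u,—)\sim(\underbrace{s,r,s,\dots}_{n},u,—)$ is a *$\sigma$-relation*; *$\sigma$-equivalence* of words is generated by these and the ordinary braid relations. $\mathcal B$ is *redundant* if, $s,t$ being the last letters of $\mathbf s,\mathbf t$, there are words $\sigma$-equivalent to $\mathbf s$ and to $\mathbf t$, with last letters $s'$ and $t'$ respectively, such that $s'=t'$ or $m(s,t)<m(s',t')<\infty$. *Operations.* For $\mathcal B$ constant and $r\in\partial J$, $\mathcal B\downarrow r$ has the same words, domain $J\cup\{r\}$, map $\sigma'$ extending $\sigma$ by $\sigma'\alpha_r=-\sum_{s\in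 S}\alpha_s\otimes x_s$, and constraints $x_s\ge0$ $(s\in S)$, $(\sigma'\alpha_r,\sigma'\alpha_s)=(\alpha_r,\alpha_s)$ $(s\in J)$, and $|\det\sigma'|=1$ if $J\cup\{r\}=S$. For $r\in J$: $r\bullet_{\rm asc}\mathcal B$ adds the constraints $\sigma\alpha_r\ge0$; $r\bullet_{\rm des}\mathcal B$ prepends $r$ to both words, replaces $\sigma$ by $r^*\sigma$ and adds $\sigma\alpha_r=-\alpha_{r^*}$; $r\,\hat\bullet_{\rm des}\,\mathcal B$ prepends $r$ to both words, replaces $\sigma$ by $r^*\sigma r|_{V_J}$ and adds $-\alpha_{r^*}\ne\sigma\alpha_r\le0$. For a ring homomorphism $\psi:\mathbb R[S]\to\mathbb R[S]$, $\mathcal B[\psi]$ arises by applying $\psi$ to $\sigma$ and $C$ and omitting trivially true constraints. **Algorithm 1** (tree $\mathscr T(\mathcal B_0\downarrow r)$ for a constant $\mathcal B_0$ with domain $K$ and $r\in\partial K$). The root is $\mathcal B_0\downarrow r$. A vertex $\mathcal B$ which is constant, invalid or redundant has no children. Otherwise, if $\mathcal B$ has finitely many solutions $\psi$, its children are the systems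 $\mathcal B[\psi]$. Otherwise write $\sigma\alpha_s=\sum_t\alpha_t\otimes\sigma_{st}$; an element $s$ of the domain is a *conditional* (respectively *unconditional*) *descent* if for some $t\in S$ the equalities and weak inequalities in $C$ together with $\sigma_{st}>0$ (respectively $\sigma_{st}\ge0$) are infeasible (the exclusions $-\alpha_{r^*}\ne\sigma\alpha_r$ are disregarded in this test, but not in the definition of a solution). If unconditional descents exist and $s$ is the least one, the children are $s\bullet_{\rm des}\mathcal B$ and $s\,\hat\bullet_{\rm des}\,\mathcal B$; if not, and $s$ is the least conditional descent, they are $s\bullet_{\rm asc}\mathcal B$, $s\bullet_{\rm des}\mathcal B$, $s\,\hat\bullet_{\rm des}\,\mathcal B$; if there is none, $\mathcal B$ is its own child (so the tree is infinite). **Algorithm 2** (on a constant $\mathcal B$ with domain $J$). Let $\mathcal B_0=\mathcal B$. Given $\mathcal B_i=(\{\mathbf s_i,\mathbf t_i\},\sigma_i,\varnothing)$: stop with no output if $\mathcal B_i$ is invalid, redundant or descent-periodic; otherwise stop with output $\mathcal B_i$ if $\mathrm{Des}(\mathcal B_i)=\{s\in J:\sigma_i\alpha_s<0\}$ is empty;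 otherwise let $r=\min\mathrm{Des}(\mathcal B_i)$, let $\mathcal B_{i+1}$ be $r\bullet_{\rm des}\mathcal B_i$ if $\sigma_i\alpha_r=-\alpha_{r^*}$ and $r\,\hat\bullet_{\rm des}\,\mathcal B_i$ otherwise, with constraints removed, and continue. Here $\mathcal B_i$ is *descent-periodic* if for some $p\ge1$, $q\ge2$ with $pq\le i$ and some $r_1,\dots,r_p\in J$, $r_{p+1}:=r_1$: (i) $\mathbf s_i$ and $\mathbf t_i$ begin with $(r_p,\dots,r_1)$ repeated $q$ times; and, if $\lambda_j(n):V_J\to V$ denotes the linear map whose matrix entries are the polynomials in $n$ of degree $<q$ with $\sigma_{(i-pq)+j+np}=\lambda_j(n)$ for $1\le j\le p$, $0\le n<q$, then (ii) for each $j$, all $\lambda_j(n)\alpha_{r_{j+1}}$ $(n\ge 0)$ are $<0$ and either none or all of them equal $-\alpha_{r_{j+1}^*}$; (iii) $\lambda_1(n+1)=\lambda_p(n)\bullet r_1$ and $\lambda_j(n+1)=\lambda_{j-1}(n+1)\bullet r_j$ $(2\le j\le p)$ for all $n\ge0$, where $\lambda\bullet r=r^*\lambda$ if $\lambda\alpha_r=-\alpha_{r^*}$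 and $\lambda\bullet r=r^*\lambda r|_{V_J}$ otherwise. **Algorithm 3** (forest $\mathscr F_{s,t}=\mathscr F_{s,t}(W,S,*)$, $s\ne t$). The roots are the two constant systems $\mathcal B^\theta_{s,t}$ ($\theta$ a bijection of $\{s,t\}$) with words $(\dots,s,t,s)$ and $(\dots,t,s,t)$ of length $m_\theta(s,t)$, domain $\{s,t\}$, and $\sigma\alpha_s=\alpha_{\theta(s)^*}$, $\sigma\alpha_t=\alpha_{\theta(t)^*}$. The children of a vertex $\mathcal B$ with domain $K$ are the outputs of Algorithm 2 on the constant leaves of the trees $\mathscr T(\mathcal B\downarrow r)$, $r\in\partial K$. The forest *exists* if $m(s,t)<\infty$, all these trees are finite, and Algorithm 2 always terminates. A vertex is *trivial* if its two words lie in a common $\hat{\mathcal R}_*(z)$, $z\in\mathcal I_*$, and $\sigma$ is the identity on the domain. $\mathscr R_{s,t}(W,S,*)$ is the set of relations $(\mathbf s,—)\sim(\mathbf t,—)$ for the words $\mathbf s,\mathbf t$ of trivial vertices of $\mathscr F_{s,t}$. **Configurations.** $(W,S,J,*)$ is a *bounded Coxeter system* if $J=J^*\subseteq S$ and $\partial_SJ\cup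 J\ne S$. A *bounded embedding* $(W,S,J,*)\to(W',S',\diamond)$ is an injective homomorphism $\phi:W\to W'$ with $\phi(S)\subseteq\{1\}\cup S'$, $\phi(w^*)=\phi(w)^\diamond$ for all $w \in W$, and $\partial_{S'}\phi(J)=\phi(\partial_SJ)$. $(W,S,J,*\,|\,s,t)$ is a *parabolic configuration* if $(W,S,J,*)$ is bounded, $\mathscr F_{s,t}(W,S,*)$ exists, and every vertex of it, with domain $K$ and map $\sigma$, satisfies $\partial_SK\cup K\subseteq J$ and $\sigma(V_K)\subseteq V_J$. **Theorem.** Let $(W,S,*)$ and $(W',S',\diamond)$ be twisted Coxeter systems with $S,S'$ finite and totally ordered, let $\phi:S\to S'$ be order-preserving, let $s\ne t$ in $S$, and put $s'=\phi(s)$, $t'=\phi(t)$. Suppose $(W,S,J,*\,|\,s,t)$ is a parabolic configuration and $\phi$ extends to a bounded embedding $(W,S,J,*)\to(W',S',\diamond)$. Then $\mathscr F_{s,t}(W,S,*)$ and $\mathscr F_{s',t'}(W',S',\diamond)$ both exist; $\mathscr R_{s,t}(W,S,*)$ and $\mathscr R_{s',t'}(W',S',\diamond)$ consist of generalized half-braid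 relations, and $\phi$ induces a bijection from the first to the second, sending $(\mathbf a,—)\sim(\mathbf b,—)$ to $(\phi(\mathbf a),—)\sim(\phi(\mathbf b),—)$. Moreover $(W',S',\phi(J),\diamond\,|\,s',t')$ is also a parabolic configuration. -/

import Mathlib

/-- A twisted Coxeter system `(W, S, *)`: `S` is a set of elements of `W` such that `(W, S)` is a
Coxeter system, and `*` is an automorphism of `W` with `** = id` and `S* = S`. -/
structure TwistedCoxeterSystem (W : Type*) [Group W] where
  /-- the set of simple generators -/
  S : Set W
  /-- the Coxeter matrix -/
  M : CoxeterMatrix S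
  /-- the Coxeter presentation of `W` -/
  cs : CoxeterSystem M W
  simple_eq : ∀ s : S, cs.simple s = (s : W)
  /-- the automorphism `*` -/
  star : W ≃* W
  star_star : ∀ w, star (star w) = w
  star_mem : ∀ s ∈ S, star s ∈ S

/-- Constraints on elements of `ℝ[S]`; `ne v w` is a constraint between two vectors of
`V ⊗ ℝ[S]`, given by their coordinates. -/
inductive BraidConstraint (S : Type*) where
  /-- `p = q` -/
  | eq (p q : MvPolynomial S ℝ)
  /-- `p ≤ q` -/
  | le (p q : MvPolynomial S ℝ)
  /-- `|p| = q` -/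
  | absEq (p q : MvPolynomial S ℝ)
  /-- `v ≠ w` -/
  | ne (v w : S → MvPolynomial S ℝ)

namespace BraidConstraint

variable {S : Type*}

/-- The ring homomorphism `ψ` transforms the constraint into a true statement. -/
def Holds (ψ : MvPolynomial S ℝ →+* ℝ) : BraidConstraint S → Prop
  | eq p q => ψ p = ψ q
  | le p q => ψ p ≤ ψ q
  | absEq p q => |ψ p| = ψ q
  | ne v w => (fun t => ψ (v t)) ≠ (fun t => ψ (w t))

/-- The constraint is an exclusion `v ≠ w`, rather than an equality or an inequality
between elements of `ℝ[S]`. -/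
def IsExclusion : BraidConstraint S → Prop
  | ne _ _ => True
  | _ => False

/-- Apply a ring homomorphism to all polynomials in a constraint. -/
noncomputable def map (ψ : MvPolynomial S ℝ →+* MvPolynomial S ℝ) : BraidConstraint S → BraidConstraint S
  | eq p q => eq (ψ p) (ψ q)
  | le p q => le (ψ p) (ψ q)
  | absEq p q => absEq (ψ p) (ψ q)
  | ne v w => ne (fun t => ψ (v t)) (fun t => ψ (w t))

/-- A trivially true constraint: one that is satisfied whatever the values of the variables. -/
def TriviallyTrue (c : BraidConstraint S) : Prop :=
  ∀ ψ : MvPolynomial S ℝ →+* ℝ, c.Holds ψ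

end BraidConstraint

/-- The word `(a, b, a, b, …)` with `k` terms. -/
def altWord {S : Type*} (a b : S) : ℕ → List S
  | 0 => []
  | k + 1 => a :: altWord b a k

/-- The symmetric word relation `(a₁,…,aₙ,—) ∼ (b₁,…,bₙ,—)`. -/
def headRelation {S : Type*} (a b : List S) (x y : List S) : Prop :=
  ∃ c : List S, (x = a ++ c ∧ y = b ++ c) ∨ (x = b ++ c ∧ y = a ++ c)

namespace TwistedCoxeterSystem

noncomputable section

section Basic

variable {W : Type*} [Group W] (T : TwistedCoxeterSystem W)

/-- The action of `*` on simple generators. -/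
def starS (s : T.S) : T.S := ⟨T.star s, T.star_mem s s.2⟩

/-- `m(s,t)` is the order of `st` in `W`; the value `0` means `m(s,t) = ∞`. -/
def m (s t : T.S) : ℕ := orderOf ((s : W) * (t : W))

/-- `∂_K J`: the elements of `K - J` with `m(s,t) > 2` for some `t ∈ J` (`m = 0` means `∞`). -/
def bdry (K J : Set T.S) : Set T.S :=
  {s | s ∈ K ∧ s ∉ J ∧ ∃ t ∈ J, T.m s t = 0 ∨ 2 < T.m s t}

/-- The Demazure product `s₁ ∘ s₂ ∘ ⋯ ∘ sₙ` of a word of simple generators, computed by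
`w ∘ s = ws` if `ℓ(ws) > ℓ(w)`, and `w ∘ s = w` otherwise. -/
def demazure (w : List T.S) : W :=
  open Classical in
  w.foldl (fun v s => if T.cs.length v < T.cs.length (v * (s : W)) then v * (s : W) else v) 1

/-- `sₙ* ∘ ⋯ ∘ s₂* ∘ s₁* ∘ s₁ ∘ s₂ ∘ ⋯ ∘ sₙ`. -/
def invProduct (w : List T.S) : W := T.demazure ((w.map T.starS).reverse ++ w)

/-- The set of twisted involutions. -/
def twistedInvolutions : Set W := {w | T.star w = w⁻¹}

/-- The set of involution words of `z`: the words of minimal length with `invProduct w = z`. -/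
def invWords (z : W) : Set (List T.S) :=
  {w | T.invProduct w = z ∧ ∀ w' : List T.S, T.invProduct w' = z → w.length ≤ w'.length}

/-- The generalized half-braid relations: all
`(r₁,…,r_k,s,t,s,…,—) ∼ (r₁,…,r_k,t,s,t,…,—)` (with `n ≥ 1` alternating terms) for which the
two displayed words are involution words of the same twisted involution. -/
def genHalfBraidRelations : Set (List T.S → List T.S → Prop) :=
  {ρ | ∃ (s t : T.S) (r : List T.S) (n : ℕ), s ≠ t ∧ 1 ≤ n ∧
    (∃ z ∈ T.twistedInvolutions,
      r ++ altWord s t n ∈ T.invWords z ∧ r ++ altWord t s n ∈ T.invWords z) ∧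
    ρ = headRelation (r ++ altWord s t n) (r ++ altWord t s n)}

/-- The (ordinary) braid relations, on words. -/
def BraidRel (a b : List T.S) : Prop :=
  ∃ (s t : T.S) (p q : List T.S), T.m s t ≠ 0 ∧
    a = p ++ altWord s t (T.m s t) ++ q ∧ b = p ++ altWord t s (T.m s t) ++ q

/-- The bilinear form `(α_s, α_t) = -cos(π / m(s,t))`, which is `-1` if `m(s,t) = ∞`
(consistent with `π / 0 = 0`). -/
def form (s t : T.S) : ℝ := -Real.cos (Real.pi / (T.m s t : ℝ))

/-- The simple root `α_s`, as a coordinate vector with entries in `A`. -/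
def root (A : Type*) [CommRing A] (s : T.S) : T.S → A :=
  open Classical in fun t => if t = s then 1 else 0

/-- For a bijection `θ` of `{s,t}` (the transposition if `swap` is true, the identity otherwise),
the number `m_θ(s,t)`; as before `0` means `∞`. -/
def mTheta (swap : Bool) (s t : T.S) : ℕ :=
  if T.m s t = 0 then 0
  else if T.m s t % 2 = 1 then (T.m s t + 1) / 2
  else if swap then T.m s t / 2 else T.m s t / 2 + 1

/-- `θ(s)` for a bijection `θ` of `{s,t}`. -/
def theta (swap : Bool) (s t : T.S) : T.S := if swap then t else s

variable [Fintype T.S]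

/-- The extension of the bilinear form to `V ⊗ A`. -/
def bilin {A : Type*} [CommRing A] [Algebra ℝ A] (v w : T.S → A) : A :=
  ∑ s, ∑ t, algebraMap ℝ A (T.form s t) * v s * w t

/-- The action of the simple generator `r` on `V ⊗ A`: `r v = v - 2 (α_r, v) α_r`. -/
def reflect {A : Type*} [CommRing A] [Algebra ℝ A] (r : T.S) (v : T.S → A) : T.S → A :=
  fun u => v u - 2 * T.bilin (T.root A r) v * T.root A r u

/-- `r* ∘ σ`, for a linear map `σ` given by the vectors `σ α_s`. -/
def leftMul {A : Type*} [CommRing A] [Algebra ℝ A] (r : T.S) (σ : T.S → T.S → A) :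
    T.S → T.S → A :=
  fun s => T.reflect (T.starS r) (σ s)

/-- `r* ∘ σ ∘ r`, for a linear map `σ` given by the vectors `σ α_s`;
note that `r α_s = α_s - 2 (α_r, α_s) α_r`. -/
def conj {A : Type*} [CommRing A] [Algebra ℝ A] (r : T.S) (σ : T.S → T.S → A) :
    T.S → T.S → A :=
  fun s => T.reflect (T.starS r) (fun u => σ s u - algebraMap ℝ A (2 * T.form r s) * σ r u)

end Basic

/-- A braid system `({𝐬,𝐭}, σ, C)`. The map `σ : V_J → V ⊗ ℝ[S]` is given by the coordinates
`σ α_s = ∑ t, α_t ⊗ σ s t` for `s ∈ dom = J`; the values `σ s` for `s ∉ J` are irrelevant. -/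
structure BraidSystem {W : Type*} [Group W] (T : TwistedCoxeterSystem W) where
  /-- the word `𝐬` -/
  word₁ : List T.S
  /-- the word `𝐭` -/
  word₂ : List T.S
  length_eq : word₁.length = word₂.length
  /-- the domain -/
  dom : Set T.S
  /-- the linear map -/
  σ : T.S → T.S → MvPolynomial T.S ℝ
  /-- the set of constraints -/
  C : Set (BraidConstraint T.S)

namespace BraidSystem

section Defs

variable {W : Type*} [Group W] {T : TwistedCoxeterSystem W} (B : BraidSystem T)

/-- `σ V_J ⊆ V` and there are no constraints. -/
def IsConstant : Prop :=
  (∀ s ∈ B.dom, ∀ t, ∃ a : ℝ, B.σ s t = MvPolynomial.C a) ∧ B.C = ∅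

/-- `ψ` is a solution: all constraints become true, and `(1 ⊗ ψ) ∘ σ` is root-preserving. The
order on `T.S → ℝ` is the one with `0 < v` iff `v` is nonzero with nonnegative coordinates. -/
def IsSolution (ψ : MvPolynomial T.S ℝ →+* ℝ) : Prop :=
  (∀ c ∈ B.C, c.Holds ψ) ∧
    ∀ s ∈ B.dom, (fun t => ψ (B.σ s t)) < 0 ∨ 0 < (fun t => ψ (B.σ s t))

/-- Both words are reduced and there is a solution. -/
def IsValid : Prop :=
  T.cs.IsReduced B.word₁ ∧ T.cs.IsReduced B.word₂ ∧ ∃ ψ, B.IsSolution ψ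

/-- The `σ`-relations. -/
def SigmaRel (a b : List T.S) : Prop :=
  ∃ r ∈ B.dom, ∃ s ∈ B.dom, ∃ swap : Bool,
    B.σ r = T.root _ (T.starS (T.theta swap r s)) ∧
    B.σ s = T.root _ (T.starS (T.theta swap s r)) ∧
    T.m r s ≠ 0 ∧ T.mTheta swap r s < T.m r s ∧
    ∃ t ∈ B.dom, ∃ c : List T.S,
      a = altWord r s (T.mTheta swap r s) ++ t :: c ∧
      b = altWord s r (T.mTheta swap r s) ++ t :: c

/-- `σ`-equivalence of words: generated by the braid relations and the `σ`-relations. -/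
def SigmaEquiv : List T.S → List T.S → Prop :=
  Relation.EqvGen (fun a b => T.BraidRel a b ∨ B.SigmaRel a b)

/-- Redundant braid systems. -/
def IsRedundant : Prop :=
  ∃ (a b : List T.S) (s t s' t' : T.S),
    B.word₁.getLast? = some s ∧ B.word₂.getLast? = some t ∧
    B.SigmaEquiv B.word₁ a ∧ B.SigmaEquiv B.word₂ b ∧
    a.getLast? = some s' ∧ b.getLast? = some t' ∧
    (s' = t' ∨ (T.m s t ≠ 0 ∧ T.m s' t' ≠ 0 ∧ T.m s t < T.m s' t'))

/-- `B[ψ]`. -/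
def subst (ψ : MvPolynomial T.S ℝ →+* MvPolynomial T.S ℝ) : BraidSystem T where
  word₁ := B.word₁
  word₂ := B.word₂
  length_eq := B.length_eq
  dom := B.dom
  σ := fun s t => ψ (B.σ s t)
  C := {c | c ∈ BraidConstraint.map ψ '' B.C ∧ ¬ c.TriviallyTrue}

/-- `r •_asc B`. -/
def asc (r : T.S) : BraidSystem T where
  word₁ := B.word₁
  word₂ := B.word₂
  length_eq := B.length_eq
  dom := B.dom
  σ := B.σ
  C := B.C ∪ Set.range (fun t => BraidConstraint.le 0 (B.σ r t))

/-- The equalities and inequalities of `C` (all constraints except the exclusions `v ≠ w`) hold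
for `ψ`; these are the constraints of the associated linear program. -/
def HoldsProgram (ψ : MvPolynomial T.S ℝ →+* ℝ) : Prop :=
  ∀ c ∈ B.C, ¬ c.IsExclusion → c.Holds ψ

/-- Conditional descents: for some `t`, the constraints together with `σ_{st} > 0` are
infeasible. -/
def conditionalDescents : Set T.S :=
  {s | s ∈ B.dom ∧ ∃ t, ¬ ∃ ψ, B.HoldsProgram ψ ∧ 0 < ψ (B.σ s t)}

/-- Unconditional descents: for some `t`, the constraints together with `σ_{st} ≥ 0` are
infeasible. -/
def unconditionalDescents : Set T.S :=
  {s | s ∈ B.dom ∧ ∃ t, ¬ ∃ ψ, B.HoldsProgram ψ ∧ 0 ≤ ψ (B.σ s t)}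

/-- The descent set. -/
def descents : Set T.S :=
  {s | s ∈ B.dom ∧ ∃ a : T.S → ℝ, (∀ t, B.σ s t = MvPolynomial.C (a t)) ∧ a < 0}

/-- Forget all constraints. -/
def dropConstraints : BraidSystem T := { B with C := ∅ }

/-- A trivial braid system. -/
def IsTrivial : Prop :=
  (∃ z ∈ T.twistedInvolutions, B.word₁ ∈ T.invWords z ∧ B.word₂ ∈ T.invWords z) ∧
    ∀ s ∈ B.dom, B.σ s = T.root _ s

end Defs

section Operations

variable {W : Type*} [Group W] {T : TwistedCoxeterSystem W} [Fintype T.S] (B : BraidSystem T)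

/-- The map `σ'` of `B ↓ r`. -/
def downMap (r : T.S) : T.S → T.S → MvPolynomial T.S ℝ :=
  open Classical in fun s => if s = r then fun t => -MvPolynomial.X t else B.σ s

/-- `B ↓ r`, for a constant system `B` and `r ∈ ∂J`. -/
def down (r : T.S) : BraidSystem T where
  word₁ := B.word₁
  word₂ := B.word₂
  length_eq := B.length_eq
  dom := insert r B.dom
  σ := B.downMap r
  C := Set.range (fun s => BraidConstraint.le 0 (MvPolynomial.X s)) ∪
    {c | ∃ s ∈ B.dom, c = BraidConstraint.eq (T.bilin (B.downMap r r) (B.downMap r s))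
      (MvPolynomial.C (T.form r s))} ∪
    {c | insert r B.dom = Set.univ ∧
      c = BraidConstraint.absEq (open Classical in Matrix.det (Matrix.of (B.downMap r))) 1}

/-- `r •_des B`. -/
def des (r : T.S) : BraidSystem T where
  word₁ := r :: B.word₁
  word₂ := r :: B.word₂
  length_eq := congrArg Nat.succ B.length_eq
  dom := B.dom
  σ := T.leftMul r B.σ
  C := B.C ∪ Set.range (fun t => BraidConstraint.eq (B.σ r t) (-T.root _ (T.starS r) t))

/-- `r •̂_des B`. -/
def hatDes (r : T.S) : BraidSystem T where
  word₁ := r :: B.word₁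
  word₂ := r :: B.word₂
  length_eq := congrArg Nat.succ B.length_eq
  dom := B.dom
  σ := T.conj r B.σ
  C := B.C ∪ (Set.range (fun t => BraidConstraint.le (B.σ r t) 0) ∪
    {BraidConstraint.ne (-T.root _ (T.starS r)) (B.σ r)})

end Operations

section Algorithms

variable {W : Type*} [Group W] {T : TwistedCoxeterSystem W} [Fintype T.S] [LinearOrder T.S]

/-- A vertex which is a leaf by the first rule of the expansion algorithm. -/
def IsStopped (B : BraidSystem T) : Prop := B.IsConstant ∨ ¬ B.IsValid ∨ B.IsRedundant

/-- The expansion algorithm: `ExpandChild B B'` means that `B'` is a child of `B`. -/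
inductive ExpandChild : BraidSystem T → BraidSystem T → Prop
  | solve (B : BraidSystem T) (ψ : MvPolynomial T.S ℝ →+* ℝ) :
      ¬ B.IsStopped → {χ | B.IsSolution χ}.Finite → B.IsSolution ψ →
      ExpandChild B (B.subst (MvPolynomial.C.comp ψ))
  | unconditional_des (B : BraidSystem T) (s : T.S) :
      ¬ B.IsStopped → ¬ {χ | B.IsSolution χ}.Finite → IsLeast B.unconditionalDescents s →
      ExpandChild B (B.des s)
  | unconditional_hatDes (B : BraidSystem T) (s : T.S) :
      ¬ B.IsStopped → ¬ {χ | B.IsSolution χ}.Finite → IsLeast B.unconditionalDescents s →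
      ExpandChild B (B.hatDes s)
  | conditional_asc (B : BraidSystem T) (s : T.S) :
      ¬ B.IsStopped → ¬ {χ | B.IsSolution χ}.Finite → B.unconditionalDescents = ∅ →
      IsLeast B.conditionalDescents s → ExpandChild B (B.asc s)
  | conditional_des (B : BraidSystem T) (s : T.S) :
      ¬ B.IsStopped → ¬ {χ | B.IsSolution χ}.Finite → B.unconditionalDescents = ∅ →
      IsLeast B.conditionalDescents s → ExpandChild B (B.des s)
  | conditional_hatDes (B : BraidSystem T) (s : T.S) :
      ¬ B.IsStopped → ¬ {χ | B.IsSolution χ}.Finite → B.unconditionalDescents = ∅ →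
      IsLeast B.conditionalDescents s → ExpandChild B (B.hatDes s)
  | loop (B : BraidSystem T) :
      ¬ B.IsStopped → ¬ {χ | B.IsSolution χ}.Finite → B.unconditionalDescents = ∅ →
      B.conditionalDescents = ∅ → ExpandChild B B

/-- The tree with root `B` is finite. As every vertex has finitely many children, this means that
there is no infinite branch, i.e. that `B` is accessible for the child relation. -/
def TreeFinite (B : BraidSystem T) : Prop := Acc (fun B' A => ExpandChild A B') B

/-- `L` is a constant leaf of the tree with root `B` (constant vertices are leaves). -/
def IsConstantLeaf (B L : BraidSystem T) : Prop :=
  Relation.ReflTransGen ExpandChild B L ∧ L.IsConstant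

/-- One iteration of the descent elimination algorithm: apply `r •_des` or `r •̂_des` for the least
descent `r` (nothing is done if there is none), and regard the result as constant. -/
def elimStep (B : BraidSystem T) : BraidSystem T :=
  open Classical in
  if h : ∃ r, IsLeast B.descents r then
    if B.σ h.choose = -T.root _ (T.starS h.choose) then (B.des h.choose).dropConstraints
    else (B.hatDes h.choose).dropConstraints
  else B

/-- The sequence `B₀ = B, B₁, B₂, …` of the descent elimination algorithm. -/
def elimSeq (B : BraidSystem T) (i : ℕ) : BraidSystem T := elimStep^[i] B

/-- `λ • r`, for a linear map `λ : V_J → V` and `r ∈ J`. -/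
def bullet (l : T.S → T.S → ℝ) (r : T.S) : T.S → T.S → ℝ :=
  open Classical in if l r = -T.root ℝ (T.starS r) then T.leftMul r l else T.conj r l

/-- The `i`-th system of the sequence is descent-periodic. Here `r 1, …, r p` are the periodic
descents, `r (p + 1) = r 1`, and `l j n` is the map `λ_j(n)`, whose coordinates are the values at
`n` of the interpolating polynomials `f s t j` of degree less than `q`. -/
def DescentPeriodic (B : BraidSystem T) (i : ℕ) : Prop :=
  ∃ (p q : ℕ) (r : ℕ → T.S) (f : T.S → T.S → ℕ → Polynomial ℝ) (l : ℕ → ℕ → T.S → T.S → ℝ),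
    1 ≤ p ∧ 2 ≤ q ∧ p * q ≤ i ∧ (∀ j ∈ Finset.Icc 1 p, r j ∈ B.dom) ∧ r (p + 1) = r 1 ∧
    (∀ j n s t, l j n s t = (f s t j).eval (n : ℝ)) ∧
    ((List.replicate q ((List.range p).map (fun k => r (k + 1))).reverse).flatten
      <+: (B.elimSeq i).word₁) ∧
    ((List.replicate q ((List.range p).map (fun k => r (k + 1))).reverse).flatten
      <+: (B.elimSeq i).word₂) ∧
    (∀ s ∈ B.dom, ∀ t, ∀ j ∈ Finset.Icc 1 p, (f s t j).degree < (q : WithBot ℕ) ∧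
      ∀ n < q, (B.elimSeq (i - p * q + j + n * p)).σ s t = MvPolynomial.C (l j n s t)) ∧
    (∀ j ∈ Finset.Icc 1 p, (∀ n, l j n (r (j + 1)) < 0) ∧
      ¬ (-T.root ℝ (T.starS (r (j + 1))) ∈ Set.range (fun n => l j n (r (j + 1))) ∧
        Set.range (fun n => l j n (r (j + 1))) ≠ {-T.root ℝ (T.starS (r (j + 1)))})) ∧
    (∀ n, ∀ s ∈ B.dom, l 1 (n + 1) s = bullet (l p n) (r 1) s ∧
      ∀ j ∈ Finset.Icc 2 p, l j (n + 1) s = bullet (l (j - 1) (n + 1)) (r j) s)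

/-- At stage `i` the descent elimination algorithm stops with no output. -/
def ElimFails (B : BraidSystem T) (i : ℕ) : Prop :=
  ¬ (B.elimSeq i).IsValid ∨ (B.elimSeq i).IsRedundant ∨ B.DescentPeriodic i

/-- The descent elimination algorithm terminates on `B` (with or without an output). -/
def ElimTerminates (B : BraidSystem T) : Prop :=
  ∃ i, B.ElimFails i ∨ (B.elimSeq i).descents = ∅

/-- The descent elimination algorithm terminates on `B` with output `B'`. -/
def ElimOutput (B B' : BraidSystem T) : Prop :=
  ∃ i, (∀ j < i, ¬ B.ElimFails j ∧ (B.elimSeq j).descents ≠ ∅) ∧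
    ¬ B.ElimFails i ∧ (B.elimSeq i).descents = ∅ ∧ B' = B.elimSeq i

/-- `B'` is a child of `B` in a forest `F_{s,t}`. -/
def ForestChild (B B' : BraidSystem T) : Prop :=
  ∃ r ∈ T.bdry Set.univ B.dom, ∃ L, IsConstantLeaf (B.down r) L ∧ L.ElimOutput B'

end Algorithms

end BraidSystem

section Forest

variable {W : Type*} [Group W] (T : TwistedCoxeterSystem W)

/-- The roots `B_{s,t}^θ`, with words `(…,s,t,s)` and `(…,t,s,t)` of length `m_θ(s,t)`,
domain `{s,t}`, and `σ α_s = α_{θ(s)*}`, `σ α_t = α_{θ(t)*}`. -/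
def rootSystem (swap : Bool) (s t : T.S) : BraidSystem T where
  word₁ := (altWord s t (T.mTheta swap s t)).reverse
  word₂ := (altWord t s (T.mTheta swap s t)).reverse
  length_eq := by
    have h : ∀ (k : ℕ) (a b : T.S), (altWord a b k).length = k := by
      intro k
      induction k with
      | zero => intro a b; rfl
      | succ k ih => intro a b; simp [altWord, ih]
    simp [h]
  dom := {s, t}
  σ := open Classical in fun u =>
    if u = s then T.root _ (T.starS (T.theta swap s t))
    else if u = t then T.root _ (T.starS (T.theta swap t s)) else 0
  C := ∅

/-- `(W, S, J, *)` is a bounded Coxeter system. -/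
def IsBounded (J : Set T.S) : Prop :=
  T.starS '' J = J ∧ T.bdry Set.univ J ∪ J ≠ Set.univ

variable [Fintype T.S] [LinearOrder T.S]

/-- The set of vertices of the forest `F_{s,t}`. -/
def forestVertices (s t : T.S) : Set (BraidSystem T) :=
  {B | ∃ swap, Relation.ReflTransGen BraidSystem.ForestChild (T.rootSystem swap s t) B}

/-- The forest `F_{s,t}` exists: its roots are defined (`m(s,t) < ∞`), and at each vertex `B`,
each tree with root `B ↓ r` is finite and the descent elimination algorithm terminates on each of
its constant leaves. (The number of children is then finite and domains strictly increase along
edges, so the forest is finite.) -/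
def ForestExists (s t : T.S) : Prop :=
  T.m s t ≠ 0 ∧ ∀ B ∈ T.forestVertices s t, ∀ r ∈ T.bdry Set.univ B.dom,
    (B.down r).TreeFinite ∧ ∀ L, (B.down r).IsConstantLeaf L → L.ElimTerminates

/-- `R_{s,t}`: the word relations corresponding to the trivial vertices of `F_{s,t}`. -/
def inducedRelations (s t : T.S) : Set (List T.S → List T.S → Prop) :=
  {ρ | ∃ B ∈ T.forestVertices s t, B.IsTrivial ∧ ρ = headRelation B.word₁ B.word₂}

/-- `(W, S, J, * | s, t)` is a parabolic configuration. -/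
def IsParabolicConfiguration (J : Set T.S) (s t : T.S) : Prop :=
  T.IsBounded J ∧ T.ForestExists s t ∧
    ∀ B ∈ T.forestVertices s t, T.bdry Set.univ B.dom ∪ B.dom ⊆ J ∧
      ∀ u ∈ B.dom, ∀ v ∉ J, B.σ u v = 0

end Forest

section Morphisms

variable {W W' : Type*} [Group W] [Group W'] (T : TwistedCoxeterSystem W)
  (T' : TwistedCoxeterSystem W')

/-- Morphisms of twisted Coxeter systems. -/
def IsMorphism (f : W →* W') : Prop :=
  (∀ s ∈ T.S, f s = 1 ∨ f s ∈ T'.S) ∧ ∀ w, f (T.star w) = T'.star (f w)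

/-- `f` is a bounded embedding `(W, S, J, *) → (W', S', ⋄)`. -/
def IsBoundedEmbedding (J : Set T.S) (f : W →* W') : Prop :=
  T.IsBounded J ∧ IsMorphism T T' f ∧ Function.Injective f ∧
    T'.bdry Set.univ {x | ∃ s ∈ J, f s = x} = {x | ∃ s ∈ T.bdry Set.univ J, f s = x}

end Morphisms

end

end TwistedCoxeterSystem

/-!
The homomorphism `f` identifies `W` with a parabolic subgroup of `W'`. By the exchange condition,
the inclusion preserves lengths, reduced words and Demazure products, and every word of the larger
system whose Demazure product lies in `W` is a word of `W`; so involution words correspond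
(`IsInclusion.mem_invWords_map_iff`). What remains is to run the two forests in parallel.

Since `(W, S, J, *)` is bounded, there is a generator `s₀` of `W` which is neither in `J` nor
adjacent to `J`. As `∂J` does not grow, all generators of `W'` outside `φ(S)` share this property.
All maps `σ` which occur have domain inside `J`, and only reflections in elements of `J` are
applied to them. These do not change coordinates outside `J`, and they do not see coordinates at
generators orthogonal to `J`. Hence in a system of a tree `𝒯(B ↓ r)` the coordinate at `s₀` is
always of the form `c · x_{s₀}`, the variable `x_{s₀}` occurs in no other coordinate, and the
corresponding system over `W'` differs only by having further copies of this coordinate, with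
variables of their own, at the generators outside `φ(S)` (`IsLift`, `IsSystemLift`).

The constraints on these additional variables are copies of those on `x_{s₀}`. Let
`collapse φ s₀ : S' → S` be the left inverse of `φ` which sends all additional generators to `s₀`.
Composition with `collapse` turns solutions over `W` into solutions over `W'`, and composition with
a suitable section of `collapse` leads back; the same holds for feasible points of the linear
programs (`IsConstraintLift`). So validity and the sets of descents agree. The constraints on
`x_{s₀}` are invariant under multiplication by positive numbers, so if there are finitely many
solutions then `x_{s₀}` vanishes in all of them, and likewise for the additional variables;
therefore finiteness of the solution set agrees too, and so do the solutions themselves. This makes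
the relation `IsSystemLift` a bisimulation for the expansion trees, for descent elimination
(including the test for descent-periodicity, where polynomials are compared by interpolation), and
for the forests. The condition that the forest of a parabolic configuration stays inside `J` ensures
that the determinant constraint never appears and that the bilinear constraints only involve
variables at generators in or adjacent to `J`.

That induced relations are generalized half-braid relations holds for every twisted Coxeter
system: the operations only prepend a common word to the two alternating words of a root, and the
condition on involution words is part of the definition of a trivial vertex.
-/

/-! ### The exchange condition -/

namespace CoxeterSystem

variable {B W : Type*} [Group W] {M : CoxeterMatrix B} (cs : CoxeterSystem M W)

open Classical in
/-- The permutation `(x, ε) ↦ (s x s, ε + [x = s])` of `W × ℤ/2` attached to a simple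
generator `s`. -/
noncomputable def signedConj (i : B) : Equiv.Perm (W × ZMod 2) :=
  Function.Involutive.toPerm
    (fun p => (cs.simple i * p.1 * cs.simple i, p.2 + if p.1 = cs.simple i then 1 else 0)) (by
      rintro ⟨x, e⟩
      have h : cs.simple i * x * cs.simple i = cs.simple i ↔ x = cs.simple i := by
        constructor
        · intro h
          have := congrArg (fun y => cs.simple i * y * cs.simple i) h
          simpa [mul_assoc] using this
        · rintro rfl; simp
      ext
      · simp [mul_assoc]
      · simp only [h, add_assoc]
        split_ifs
        · rw [CharTwo.add_self_eq_zero, add_zero]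
        · simp)

open Classical in
theorem signedConj_apply (i : B) (x : W) (e : ZMod 2) :
    cs.signedConj i (x, e) =
      (cs.simple i * x * cs.simple i, e + if x = cs.simple i then 1 else 0) := rfl

open Classical in
/-- The elements `t (s t)^n` with `n < 2 k` are the right inversion sequence of the word
`s t s t ⋯ s t` with `2 k` letters. If `(s t)^k = 1` then each of them occurs an even number of
times, which gives the braid relation for `signedConj`. -/
theorem signedConj_mul_pow (i j : B) (k : ℕ) (x : W) (e : ZMod 2) :
    ((cs.signedConj i * cs.signedConj j) ^ k) (x, e) =
      ((cs.simple i * cs.simple j) ^ k * x * ((cs.simple i * cs.simple j) ^ k)⁻¹,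
        e + ∑ n ∈ Finset.range (2 * k),
          if x = cs.simple j * (cs.simple i * cs.simple j) ^ n then 1 else 0) := by
  induction k with
  | zero => simp
  | succ k ih =>
    set a := cs.simple i with ha
    set b := cs.simple j with hb
    have haa : a * a = 1 := cs.simple_mul_simple_self i
    have hbb : b * b = 1 := cs.simple_mul_simple_self j
    have hai : a⁻¹ = a := cs.inv_simple i
    have hbi : b⁻¹ = b := cs.inv_simple j
    -- conjugation by `b` inverts `a b`
    have hconj : b * (a * b) * b⁻¹ = (a * b)⁻¹ := by
      simp [mul_inv_rev, hai, hbi, mul_assoc, hbb]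
    have hpow : b * (a * b) ^ k * b⁻¹ = ((a * b) ^ k)⁻¹ := by
      rw [← conj_pow, hconj, inv_pow]
    have hc : ∀ n : ℕ, ((a * b) ^ k * x * ((a * b) ^ k)⁻¹ = b * (a * b) ^ n) ↔
        x = b * (a * b) ^ (2 * k + n) := by
      intro n
      have h1 : ((a * b) ^ k)⁻¹ * b = b * (a * b) ^ k := by
        rw [← hpow]; simp [mul_assoc]
      rw [mul_inv_eq_iff_eq_mul, ← eq_inv_mul_iff_mul_eq]
      have : ((a * b) ^ k)⁻¹ * (b * (a * b) ^ n * (a * b) ^ k) = b * (a * b) ^ (2 * k + n) := by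
        rw [← mul_assoc, ← mul_assoc, h1, mul_assoc, mul_assoc, ← pow_add, ← pow_add]
        congr 2; ring
      rw [this]
    have h0 := hc 0
    have h1 := hc 1
    simp only [pow_zero, mul_one, add_zero, pow_one] at h0 h1
    rw [pow_succ', Equiv.Perm.mul_apply, ih, Equiv.Perm.mul_apply, signedConj_apply,
      signedConj_apply, ← ha, ← hb]
    have h2 : (b * ((a * b) ^ k * x * ((a * b) ^ k)⁻¹) * b = a) ↔
        x = b * (a * b) ^ (2 * k + 1) := by
      rw [← h1]
      generalize (a * b) ^ k * x * ((a * b) ^ k)⁻¹ = y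
      constructor
      · intro h
        have h' := congrArg (fun z => b * z * b) h
        simp only [mul_assoc, hbb, mul_one] at h'
        rwa [← mul_assoc b b, hbb, one_mul] at h'
      · rintro rfl
        simp only [mul_assoc, hbb, mul_one]
        rw [← mul_assoc b b, hbb, one_mul]
    have e2 : 2 * (k + 1) = 2 * k + 1 + 1 := by ring
    rw [e2, Finset.sum_range_succ, Finset.sum_range_succ]
    ext
    · simp only [pow_succ', mul_inv_rev, hai, hbi]; group
    · simp only [h0, h2]; ring

theorem isLiftable_signedConj : M.IsLiftable cs.signedConj := by
  classical
  intro i j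
  have hm : (cs.simple i * cs.simple j) ^ M i j = 1 := cs.simple_mul_simple_pow i j
  ext1 ⟨x, e⟩
  rw [signedConj_mul_pow, hm]
  have : ∑ n ∈ Finset.range (2 * M i j),
      (if x = cs.simple j * (cs.simple i * cs.simple j) ^ n then (1 : ZMod 2) else 0) = 0 := by
    rw [two_mul, Finset.sum_range_add]
    simp only [pow_add, hm, one_mul]
    exact CharTwo.add_self_eq_zero _
  rw [this]
  simp

/-- The action of `W` on `W × ℤ/2` extending `signedConj`. Its second component records, modulo
`2`, how often an element occurs in the right inversion sequence of a word; hence this parity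
depends only on the product of the word. -/
noncomputable def signedConjHom : W →* Equiv.Perm (W × ZMod 2) :=
  cs.lift ⟨cs.signedConj, cs.isLiftable_signedConj⟩

open Classical in
theorem signedConjHom_wordProd (ω : List B) (x : W) (e : ZMod 2) :
    cs.signedConjHom (cs.wordProd ω) (x, e) =
      (cs.wordProd ω * x * (cs.wordProd ω)⁻¹, e + ((cs.rightInvSeq ω).count x : ZMod 2)) := by
  induction ω with
  | nil => simp
  | cons i ω ih =>
    rw [wordProd_cons, map_mul, Equiv.Perm.mul_apply, ih, signedConjHom,
      cs.lift_apply_simple cs.isLiftable_signedConj, signedConj_apply, rightInvSeq,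
      List.count_cons]
    have h : (cs.wordProd ω * x * (cs.wordProd ω)⁻¹ = cs.simple i) ↔
        ((cs.wordProd ω)⁻¹ * cs.simple i * cs.wordProd ω = x) := by
      rw [mul_inv_eq_iff_eq_mul, mul_assoc, inv_mul_eq_iff_eq_mul, eq_comm]
    ext
    · simp [mul_assoc]
    · simp only [h, beq_iff_eq]
      push_cast
      split_ifs <;> ring

/-- The exchange condition: if `s` is a right descent of the product of a word, then right
multiplication by `s` amounts to deleting some letter. -/
theorem exists_wordProd_mul_simple_eq_eraseIdx (ω : List B) (i : B)
    (h : cs.length (cs.wordProd ω * cs.simple i) < cs.length (cs.wordProd ω)) :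
    ∃ j < ω.length, cs.wordProd ω * cs.simple i = cs.wordProd (ω.eraseIdx j) := by
  classical
  obtain ⟨ν, hν, hνw⟩ := cs.exists_isReduced (cs.wordProd ω * cs.simple i)
  have h0 : cs.simple i ∉ cs.rightInvSeq ν := by
    intro hmem
    have := (cs.isRightInversion_of_mem_rightInvSeq hν hmem).2
    rw [← hνw, mul_assoc, cs.simple_mul_simple_self, mul_one] at this
    omega
  have h1 : cs.wordProd ω = cs.wordProd (ν ++ [i]) := by
    rw [wordProd_append, ← hνw]; simp
  -- compare the parities of the number of occurrences of `s` for two words with equal product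
  have h2 := cs.signedConjHom_wordProd ω (cs.simple i) 0
  have h3 : cs.signedConjHom (cs.wordProd ω) (cs.simple i, 0) =
      (cs.wordProd ω * cs.simple i * (cs.wordProd ω)⁻¹, 1) := by
    rw [h1, wordProd_append, map_mul, Equiv.Perm.mul_apply, cs.signedConjHom_wordProd [i],
      cs.signedConjHom_wordProd ν]
    ext
    · simp [mul_assoc]
    · simp [List.count_eq_zero_of_not_mem h0]
  rw [h3] at h2
  have h4 : cs.simple i ∈ cs.rightInvSeq ω := by
    by_contra hn
    have := congrArg Prod.snd h2
    simp [List.count_eq_zero_of_not_mem hn] at this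
  obtain ⟨j, hj, hji⟩ := List.getElem_of_mem h4
  rw [length_rightInvSeq] at hj
  refine ⟨j, hj, ?_⟩
  rw [← cs.wordProd_mul_getD_rightInvSeq, ← hji, List.getD_eq_getElem]

end CoxeterSystem

/-! ### Inclusions of twisted Coxeter systems -/

namespace TwistedCoxeterSystem

section Inclusion

variable {W W' : Type*} [Group W] [Group W']

theorem wordProd_eq (T : TwistedCoxeterSystem W) (ω : List T.S) :
    T.cs.wordProd ω = (ω.map (fun s : T.S => (s : W))).prod := by
  unfold CoxeterSystem.wordProd
  congr 1
  exact List.map_congr_left fun s _ => T.simple_eq s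

theorem coe_mul_self (T : TwistedCoxeterSystem W) (s : T.S) : (s : W) * s = 1 := by
  rw [← T.simple_eq]; exact T.cs.simple_mul_simple_self s

theorem m_eq_one_iff (T : TwistedCoxeterSystem W) {s t : T.S} : T.m s t = 1 ↔ s = t := by
  rw [m, orderOf_eq_one_iff]
  constructor
  · intro h
    have h1 : (s : W) * t = t * t := by rw [h, coe_mul_self]
    exact Subtype.ext (mul_right_cancel h1)
  · rintro rfl; exact T.coe_mul_self s

theorem mTheta_pos (T : TwistedCoxeterSystem W) {s t : T.S} (h : T.m s t ≠ 0) (swap : Bool) :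
    1 ≤ T.mTheta swap s t := by
  unfold mTheta
  split_ifs <;> omega

theorem demazure_concat (T : TwistedCoxeterSystem W) (w : List T.S) (s : T.S) :
    T.demazure (w ++ [s]) =
      open Classical in
      if T.cs.length (T.demazure w) < T.cs.length (T.demazure w * (s : W))
      then T.demazure w * (s : W) else T.demazure w := by
  simp [demazure, List.foldl_append]

/-- The homomorphism `f` is an injective homomorphism commuting with the involutions and mapping
each simple generator `s` to the simple generator `φ s`; it identifies `W` with a parabolic
subgroup of `W'`. -/
structure IsInclusion (T : TwistedCoxeterSystem W) (T' : TwistedCoxeterSystem W')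
    (φ : T.S → T'.S) (f : W →* W') : Prop where
  inj : Function.Injective f
  coe : ∀ x : T.S, f x = φ x
  star : ∀ w, f (T.star w) = T'.star (f w)

namespace IsInclusion

variable {T : TwistedCoxeterSystem W} {T' : TwistedCoxeterSystem W'} {φ : T.S → T'.S}
  {f : W →* W'}

theorem injective_gen (hf : IsInclusion T T' φ f) : Function.Injective φ := fun x y h =>
  Subtype.ext (hf.inj (by rw [hf.coe, hf.coe, h]))

theorem starS_map (hf : IsInclusion T T' φ f) (x : T.S) : T'.starS (φ x) = φ (T.starS x) := by
  apply Subtype.ext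
  change T'.star (φ x) = φ (T.starS x)
  rw [← hf.coe, ← hf.coe, ← hf.star]; rfl

theorem m_map (hf : IsInclusion T T' φ f) (x y : T.S) : T'.m (φ x) (φ y) = T.m x y := by
  rw [m, m, ← hf.coe, ← hf.coe, ← map_mul]
  exact orderOf_injective f hf.inj _

theorem form_map (hf : IsInclusion T T' φ f) (x y : T.S) :
    T'.form (φ x) (φ y) = T.form x y := by
  rw [form, form, hf.m_map]

theorem mTheta_map (hf : IsInclusion T T' φ f) (swap : Bool) (x y : T.S) :
    T'.mTheta swap (φ x) (φ y) = T.mTheta swap x y := by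
  simp only [mTheta, hf.m_map]

theorem wordProd_map (hf : IsInclusion T T' φ f) (ω : List T.S) :
    T'.cs.wordProd (ω.map φ) = f (T.cs.wordProd ω) := by
  rw [wordProd_eq, wordProd_eq, map_list_prod, List.map_map, List.map_map]
  congr 1
  exact List.map_congr_left fun s _ => (hf.coe s).symm

/-- A reduced word of the smaller system stays reduced: otherwise the exchange condition deletes
a letter, and this deletion can be performed in the smaller system. -/
theorem isReduced_map_of_isReduced (hf : IsInclusion T T' φ f) (ω : List T.S)
    (h : T.cs.IsReduced ω) : T'.cs.IsReduced (ω.map φ) := by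
  induction ω using List.reverseRecOn with
  | nil => simp [CoxeterSystem.IsReduced]
  | append_singleton ω s ih =>
    have h1 : T.cs.IsReduced ω := by simpa using h.take ω.length
    have h2 := ih h1
    unfold CoxeterSystem.IsReduced at h2 h ⊢
    simp only [List.length_map, List.map_append, List.map_cons, List.map_nil,
      List.length_append, List.length_cons, List.length_nil] at h2 h ⊢
    rw [CoxeterSystem.wordProd_append, CoxeterSystem.wordProd_singleton] at h ⊢
    rcases T'.cs.length_mul_simple (T'.cs.wordProd (ω.map φ)) (φ s) with h3 | h3
    · omega
    · exfalso
      obtain ⟨j, hj, hje⟩ := T'.cs.exists_wordProd_mul_simple_eq_eraseIdx (ω.map φ) (φ s)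
        (by omega)
      have h4 : T.cs.wordProd ω * T.cs.simple s = T.cs.wordProd (ω.eraseIdx j) := by
        apply hf.inj
        rw [← hf.wordProd_map (ω.eraseIdx j), ← List.eraseIdx_map, ← hje, map_mul,
          hf.wordProd_map, T.simple_eq, T'.simple_eq, hf.coe]
      have h5 := T.cs.length_wordProd_le (ω.eraseIdx j)
      rw [← h4, h, List.length_eraseIdx] at h5
      rw [List.length_map] at hj
      split_ifs at h5
      omega

theorem length_map (hf : IsInclusion T T' φ f) (w : W) :
    T'.cs.length (f w) = T.cs.length w := by
  obtain ⟨ω, hω, rfl⟩ := T.cs.exists_isReduced w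
  have := hf.isReduced_map_of_isReduced ω hω
  rw [← hf.wordProd_map, this.eq, hω.eq, List.length_map]

theorem isReduced_map_iff (hf : IsInclusion T T' φ f) (ω : List T.S) :
    T'.cs.IsReduced (ω.map φ) ↔ T.cs.IsReduced ω := by
  unfold CoxeterSystem.IsReduced
  rw [hf.wordProd_map, hf.length_map, List.length_map]

theorem demazure_map (hf : IsInclusion T T' φ f) (w : List T.S) :
    T'.demazure (w.map φ) = f (T.demazure w) := by
  induction w using List.reverseRecOn with
  | nil => simp [demazure]
  | append_singleton w s ih =>
    rw [List.map_append, List.map_singleton, demazure_concat, demazure_concat, ih, ← hf.coe,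
      ← map_mul, hf.length_map, hf.length_map]
    split_ifs <;> rfl

theorem invProduct_map (hf : IsInclusion T T' φ f) (w : List T.S) :
    T'.invProduct (w.map φ) = f (T.invProduct w) := by
  rw [invProduct, invProduct, ← hf.demazure_map]
  congr 1
  simp [hf.starS_map, Function.comp_def]

/-- The right descents of an element of the parabolic subgroup lie in it. -/
theorem exists_eq_of_descent (hf : IsInclusion T T' φ f) (v : W) (s' : T'.S)
    (h : T'.cs.length (f v * (s' : W')) < T'.cs.length (f v)) : ∃ s, φ s = s' := by
  obtain ⟨ω, -, rfl⟩ := T.cs.exists_isReduced v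
  rw [← hf.wordProd_map, ← T'.simple_eq] at h
  obtain ⟨j, -, hj⟩ := T'.cs.exists_wordProd_mul_simple_eq_eraseIdx _ _ h
  rw [List.eraseIdx_map, hf.wordProd_map, hf.wordProd_map] at hj
  have h1 : T'.cs.simple s' = f ((T.cs.wordProd ω)⁻¹ * T.cs.wordProd (ω.eraseIdx j)) := by
    rw [map_mul, map_inv, ← hj]; simp
  have h2 := T'.cs.length_simple s'
  rw [h1, hf.length_map, CoxeterSystem.length_eq_one_iff] at h2
  obtain ⟨s, hs⟩ := h2
  refine ⟨s, Subtype.ext ?_⟩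
  rw [← hf.coe, ← T.simple_eq, ← hs, ← h1, T'.simple_eq]

/-- If the Demazure product of a word lies in the parabolic subgroup, then so do its letters. -/
theorem exists_map_eq_of_demazure (hf : IsInclusion T T' φ f) (w' : List T'.S) (v : W)
    (h : T'.demazure w' = f v) : ∃ w, w' = List.map φ w := by
  induction w' using List.reverseRecOn generalizing v with
  | nil => exact ⟨[], rfl⟩
  | append_singleton w' s' ih =>
    rw [demazure_concat] at h
    have hss := T'.coe_mul_self s'
    split_ifs at h with h1
    · have h2 : T'.demazure w' = f v * s' := by rw [← h, mul_assoc, hss, mul_one]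
      obtain ⟨s, rfl⟩ := hf.exists_eq_of_descent v s' (by rwa [← h2, ← h])
      rw [← hf.coe, ← map_mul] at h2
      obtain ⟨w, rfl⟩ := ih _ h2
      exact ⟨w ++ [s], by simp⟩
    · have h3 := T'.cs.length_mul_simple_ne (f v) s'
      rw [T'.simple_eq] at h3
      rw [h] at h1
      obtain ⟨s, rfl⟩ := hf.exists_eq_of_descent v s' (by omega)
      obtain ⟨w, rfl⟩ := ih _ h
      exact ⟨w ++ [s], by simp⟩

theorem mem_invWords_map_iff (hf : IsInclusion T T' φ f) (w : List T.S) (z : W) :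
    w.map φ ∈ T'.invWords (f z) ↔ w ∈ T.invWords z := by
  unfold invWords
  simp only [Set.mem_ofPred_eq, hf.invProduct_map, hf.inj.eq_iff, List.length_map]
  refine and_congr_right fun _ => ⟨fun h u hu => ?_, fun h u' hu' => ?_⟩
  · simpa using h (u.map φ) (by rw [hf.invProduct_map, hu])
  · obtain ⟨v, hv⟩ := hf.exists_map_eq_of_demazure _ z hu'
    have hu : u' ∈ Set.range (List.map φ) := by
      rw [Set.range_list_map]
      intro x hx
      have : x ∈ List.map φ v := by rw [← hv]; simp [hx]
      obtain ⟨y, -, rfl⟩ := List.mem_map.1 this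
      exact ⟨y, rfl⟩
    obtain ⟨u, rfl⟩ := hu
    rw [hf.invProduct_map, hf.inj.eq_iff] at hu'
    simpa using h u hu'

theorem exists_mem_invWords_map_iff (hf : IsInclusion T T' φ f) (a b : List T.S) :
    (∃ z ∈ T'.twistedInvolutions, a.map φ ∈ T'.invWords z ∧ b.map φ ∈ T'.invWords z) ↔
      ∃ z ∈ T.twistedInvolutions, a ∈ T.invWords z ∧ b ∈ T.invWords z := by
  have hz : ∀ z, f z ∈ T'.twistedInvolutions ↔ z ∈ T.twistedInvolutions := fun z => by
    rw [twistedInvolutions, twistedInvolutions, Set.mem_ofPred_eq, Set.mem_ofPred_eq, ← hf.star,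
      ← map_inv, hf.inj.eq_iff]
  constructor
  · rintro ⟨z', h1, h2, h3⟩
    obtain rfl : f (T.invProduct a) = z' := by rw [← hf.invProduct_map]; exact h2.1
    rw [hf.mem_invWords_map_iff] at h2 h3
    exact ⟨_, (hz _).1 h1, h2, h3⟩
  · rintro ⟨z, h1, h2, h3⟩
    exact ⟨f z, (hz _).2 h1, (hf.mem_invWords_map_iff _ _).2 h2,
      (hf.mem_invWords_map_iff _ _).2 h3⟩

end IsInclusion

end Inclusion

theorem map_altWord {α β : Type*} (φ : α → β) (a b : α) (k : ℕ) :
    (altWord a b k).map φ = altWord (φ a) (φ b) k := by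
  induction k generalizing a b with
  | zero => rfl
  | succ k ih => simp [altWord, ih]

theorem altWord_concat {α : Type*} (a b : α) (k : ℕ) :
    altWord a b (k + 1) = altWord a b k ++ [if Even k then a else b] := by
  induction k generalizing a b with
  | zero => simp [altWord]
  | succ k ih =>
    rw [altWord, ih, altWord]
    by_cases h : Even k <;> simp [h, Nat.even_add_one]

theorem reverse_altWord {α : Type*} (a b : α) (k : ℕ) :
    (altWord a b k).reverse = if Even k then altWord b a k else altWord a b k := by
  induction k generalizing a b with
  | zero => simp [altWord]
  | succ k ih =>
    conv_lhs => rw [altWord_concat, List.reverse_concat', ih]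
    by_cases h : Even k <;> simp [h, Nat.even_add_one, altWord]

end TwistedCoxeterSystem

/-! ### Collapsing the additional generators -/

/-- The left inverse of an injection `φ` sending all points outside the range of `φ` to `a₀`. -/
noncomputable def collapse {α β : Type*} (φ : α → β) (a₀ : α) : β → α :=
  Function.extend φ id fun _ => a₀

section Collapse

variable {α β : Type*} {φ : α → β} {a₀ : α}

theorem collapse_apply (hφ : Function.Injective φ) (a : α) : collapse φ a₀ (φ a) = a :=
  hφ.extend_apply _ _ a

theorem map_collapse_of_ne (hφ : Function.Injective φ) {b : β} (h : collapse φ a₀ b ≠ a₀) :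
    φ (collapse φ a₀ b) = b := by
  by_cases hb : ∃ a, φ a = b
  · obtain ⟨a, rfl⟩ := hb
    rw [collapse_apply hφ]
  · exact absurd (Function.extend_apply' id (fun _ => a₀) b hb) h

theorem section_apply_of_ne (hφ : Function.Injective φ) {ι : α → β}
    (hι : Function.LeftInverse (collapse φ a₀) ι) {a : α} (h : a ≠ a₀) : ι a = φ a := by
  have := map_collapse_of_ne (a₀ := a₀) hφ (b := ι a) (by rwa [hι a])
  rw [← this, hι a]

theorem exists_section_apply_eq (hφ : Function.Injective φ) (b : β) :
    ∃ ι : α → β, Function.LeftInverse (collapse φ a₀) ι ∧ ι (collapse φ a₀ b) = b := by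
  classical
  refine ⟨Function.update φ (collapse φ a₀ b) b, fun a => ?_, by simp⟩
  by_cases h : a = collapse φ a₀ b
  · rw [← h, Function.update_self, h]
  · rw [Function.update_of_ne h, collapse_apply hφ]

theorem collapse_eq_of_notMem_range (hφ : Function.Injective φ) {ι : α → β}
    (hι : Function.LeftInverse (collapse φ a₀) ι) {b : β} (h : b ∉ Set.range ι) :
    collapse φ a₀ b = a₀ := by
  by_contra hb
  exact h ⟨_, (section_apply_of_ne hφ hι hb).trans (map_collapse_of_ne hφ hb)⟩

end Collapse

namespace TwistedCoxeterSystem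

variable {W W' : Type*} [Group W] [Group W']

theorem m_comm (T : TwistedCoxeterSystem W) (s t : T.S) : T.m s t = T.m t s := by
  have h : ∀ x : T.S, (x : W)⁻¹ = x := fun x => inv_eq_of_mul_eq_one_left (T.coe_mul_self x)
  rw [m, m, ← orderOf_inv, mul_inv_rev, h, h]

/-- Distinct generators which are not joined in the Coxeter graph are orthogonal. -/
theorem form_eq_zero (T : TwistedCoxeterSystem W) {J : Set T.S} {r s : T.S} (hr : r ∈ J)
    (hs : s ∉ J) (hb : s ∉ T.bdry Set.univ J) : T.form r s = 0 := by
  have h1 : ¬ (T.m s r = 0 ∨ 2 < T.m s r) := fun h => hb ⟨trivial, hs, r, hr, h⟩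
  have h2 : T.m s r ≠ 1 := fun h => hs (T.m_eq_one_iff.1 h ▸ hr)
  have h3 : T.m r s = 2 := by rw [m_comm]; omega
  simp [form, h3]

theorem root_apply (T : TwistedCoxeterSystem W) (A : Type*) [CommRing A] (s t : T.S) :
    T.root A s t = open Classical in if t = s then 1 else 0 := rfl

theorem bilin_root (T : TwistedCoxeterSystem W) [Fintype T.S] {A : Type*} [CommRing A]
    [Algebra ℝ A] (r : T.S) (v : T.S → A) :
    T.bilin (T.root A r) v = ∑ t, algebraMap ℝ A (T.form r t) * v t := by
  classical
  rw [bilin, Finset.sum_eq_single r]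
  · simp [root_apply]
  · intro s _ hs
    simp [root_apply, hs]
  · simp

/-- An inclusion of `W` into `W'` for which the subset `J` is stable under `*` and the boundary of
`J` does not grow, together with a simple generator `s₀` of `W` which is neither in `J` nor
adjacent to `J`. -/
structure IsBoundedInclusion (T : TwistedCoxeterSystem W) (T' : TwistedCoxeterSystem W')
    (φ : T.S → T'.S) (f : W →* W') (J : Set T.S) (s₀ : T.S) : Prop
    extends IsInclusion T T' φ f where
  starS_mem : ∀ r ∈ J, T.starS r ∈ J
  notMem : s₀ ∉ J
  notMem_bdry : s₀ ∉ T.bdry Set.univ J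
  bdry_image : T'.bdry Set.univ (φ '' J) = φ '' T.bdry Set.univ J

namespace IsBoundedInclusion

variable {T : TwistedCoxeterSystem W} {T' : TwistedCoxeterSystem W'} {φ : T.S → T'.S}
  {f : W →* W'} {J : Set T.S} {s₀ : T.S}

theorem ne_of_mem (h : IsBoundedInclusion T T' φ f J s₀) {r : T.S} (hr : r ∈ J) : r ≠ s₀ :=
  fun e => h.notMem (e ▸ hr)

theorem form_s₀ (h : IsBoundedInclusion T T' φ f J s₀) {r : T.S} (hr : r ∈ J) :
    T.form r s₀ = 0 :=
  T.form_eq_zero hr h.notMem h.notMem_bdry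

/-- All points in the fibre over `s₀` are orthogonal to `J`. -/
theorem form_collapse (h : IsBoundedInclusion T T' φ f J s₀) {r : T.S} (hr : r ∈ J) (t' : T'.S) :
    T'.form (φ r) t' = T.form r (collapse φ s₀ t') := by
  by_cases ht : ∃ t, φ t = t'
  · obtain ⟨t, rfl⟩ := ht
    rw [collapse_apply h.injective_gen, h.form_map]
  · have e : collapse φ s₀ t' = s₀ := Function.extend_apply' id (fun _ => s₀) t' ht
    rw [e, h.form_s₀ hr]
    refine T'.form_eq_zero (Set.mem_image_of_mem φ hr) ?_ ?_
    · rintro ⟨t, -, rfl⟩; exact ht ⟨t, rfl⟩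
    · rw [h.bdry_image]
      rintro ⟨t, -, rfl⟩; exact ht ⟨t, rfl⟩

theorem section_eq_iff (h : IsBoundedInclusion T T' φ f J s₀) {ι : T.S → T'.S}
    (hι : Function.LeftInverse (collapse φ s₀) ι) {r : T.S} (hr : r ∈ J) (t : T.S) :
    ι t = φ r ↔ t = r := by
  rw [← section_apply_of_ne h.injective_gen hι (h.ne_of_mem hr), hι.injective.eq_iff]

theorem root_section (h : IsBoundedInclusion T T' φ f J s₀) {ι : T.S → T'.S}
    (hι : Function.LeftInverse (collapse φ s₀) ι) {r : T.S} (hr : r ∈ J)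
    {A A' : Type*} [CommRing A] [CommRing A'] (g : A →+* A') (t : T.S) :
    T'.root A' (φ r) (ι t) = g (T.root A r t) := by
  rw [root_apply, root_apply]
  by_cases ht : t = r
  · simp [ht, (h.section_eq_iff hι hr r).2 rfl]
  · simp [ht, h.section_eq_iff hι hr]

variable [Fintype T.S] [Fintype T'.S]

theorem bilin_root_section (h : IsBoundedInclusion T T' φ f J s₀) {ι : T.S → T'.S}
    (hι : Function.LeftInverse (collapse φ s₀) ι) {r : T.S} (hr : r ∈ J)
    {A A' : Type*} [CommRing A] [CommRing A'] [Algebra ℝ A] [Algebra ℝ A'] (g : A →ₐ[ℝ] A')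
    {v : T.S → A} {v' : T'.S → A'} (hv : ∀ t, v' (ι t) = g (v t)) :
    T'.bilin (T'.root A' (φ r)) v' = g (T.bilin (T.root A r) v) := by
  rw [bilin_root, bilin_root, map_sum]
  symm
  refine Fintype.sum_of_injective ι hι.injective _ _ (fun t' ht' => ?_) fun t => ?_
  · rw [h.form_collapse hr, collapse_eq_of_notMem_range h.injective_gen hι ht', h.form_s₀ hr]
    simp
  · rw [h.form_collapse hr, hι t, hv, map_mul, AlgHom.commutes]

/-- Reflections in the generators of `J` commute with passing to the larger system. -/
theorem reflect_section (h : IsBoundedInclusion T T' φ f J s₀) {ι : T.S → T'.S}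
    (hι : Function.LeftInverse (collapse φ s₀) ι) {r : T.S} (hr : r ∈ J)
    {A A' : Type*} [CommRing A] [CommRing A'] [Algebra ℝ A] [Algebra ℝ A'] (g : A →ₐ[ℝ] A')
    {v : T.S → A} {v' : T'.S → A'} (hv : ∀ t, v' (ι t) = g (v t)) (t : T.S) :
    T'.reflect (φ r) v' (ι t) = g (T.reflect r v t) := by
  rw [reflect, reflect, h.bilin_root_section hι hr g hv, hv,
    h.root_section hι hr (g : A →+* A')]
  simp [map_ofNat]

end IsBoundedInclusion

/-! ### Lifts of vectors and of constraints -/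

section Lift

open MvPolynomial

/-- Every ring homomorphism `ℝ[S] → ℝ` is the evaluation at a point, since `ℝ` has no
endomorphisms apart from the identity. -/
theorem ringHom_eq_eval {σ : Type*} (ψ : MvPolynomial σ ℝ →+* ℝ) :
    ψ = eval fun i => ψ (X i) := by
  apply MvPolynomial.ringHom_ext
  · intro a
    have : ψ.comp C = RingHom.id ℝ := Subsingleton.elim _ _
    have h2 := RingHom.congr_fun this a
    rw [RingHom.comp_apply, RingHom.id_apply] at h2
    rw [h2, eval_C]
  · intro i; simp

/-- The vector `v'` over the larger system is obtained from the vector `v` over the smaller one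
by repeating the coordinate `s₀` (with a new variable each time) at all additional generators.
Moreover the coordinate of `v` at `s₀` is a multiple of the variable `x_{s₀}`, on which the other
coordinates do not depend. -/
structure IsLift {α β : Type*} (φ : α → β) (s₀ : α) (v : α → MvPolynomial α ℝ)
    (v' : β → MvPolynomial β ℝ) : Prop where
  sec : ∀ ι : α → β, Function.LeftInverse (collapse φ s₀) ι → ∀ t, v' (ι t) = rename ι (v t)
  fiber : ∃ c : ℝ, v s₀ = C c * X s₀
  indep : ∀ t ≠ s₀, ∀ p q : α → ℝ, (∀ u ≠ s₀, q u = p u) → eval q (v t) = eval p (v t)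

namespace IsLift

variable {α β : Type*} {φ : α → β} {s₀ : α} {v w : α → MvPolynomial α ℝ}
  {v' w' : β → MvPolynomial β ℝ}

theorem zero : IsLift φ s₀ (0 : α → MvPolynomial α ℝ) (0 : β → MvPolynomial β ℝ) where
  sec ι _ t := by simp
  fiber := ⟨0, by simp⟩
  indep t _ p q h := by simp

theorem coordinates : IsLift φ s₀ (fun t : α => X t) (fun t : β => X t) where
  sec ι _ t := by simp
  fiber := ⟨1, by simp⟩
  indep t ht p q h := by simp [h t ht]

theorem sub (hv : IsLift φ s₀ v v') (hw : IsLift φ s₀ w w') :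
    IsLift φ s₀ (fun t => v t - w t) (fun t => v' t - w' t) where
  sec ι hι t := by rw [hv.sec ι hι, hw.sec ι hι, map_sub]
  fiber := by
    obtain ⟨c, hc⟩ := hv.fiber
    obtain ⟨d, hd⟩ := hw.fiber
    exact ⟨c - d, by rw [hc, hd, C_sub, sub_mul]⟩
  indep t ht p q h := by
    rw [map_sub, map_sub, hv.indep t ht p q h, hw.indep t ht p q h]

theorem smul (hv : IsLift φ s₀ v v') (a : ℝ) :
    IsLift φ s₀ (fun t => C a * v t) (fun t => C a * v' t) where
  sec ι hι t := by rw [hv.sec ι hι, map_mul, rename_C]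
  fiber := by
    obtain ⟨c, hc⟩ := hv.fiber
    exact ⟨a * c, by rw [hc, C_mul, mul_assoc]⟩
  indep t ht p q h := by rw [map_mul, map_mul, hv.indep t ht p q h, eval_C, eval_C]

theorem neg (hv : IsLift φ s₀ v v') : IsLift φ s₀ (-v) (-v') := by
  convert zero.sub hv using 1 <;> ext t <;> simp

theorem eval_section (h : IsLift φ s₀ v v') {ι : α → β}
    (hι : Function.LeftInverse (collapse φ s₀) ι) (p' : β → ℝ) (t : α) :
    eval p' (v' (ι t)) = eval (p' ∘ ι) (v t) := by
  rw [h.sec ι hι, eval_rename]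

theorem eval_comp (hφ : Function.Injective φ) (h : IsLift φ s₀ v v') (p : α → ℝ) (t' : β) :
    eval (p ∘ collapse φ s₀) (v' t') = eval p (v (collapse φ s₀ t')) := by
  obtain ⟨ι, hι, e⟩ := exists_section_apply_eq (a₀ := s₀) hφ t'
  conv_lhs => rw [← e, h.eval_section hι]
  rw [Function.comp_assoc, hι.comp_eq_id, Function.comp_id]

theorem eval_fiber (hφ : Function.Injective φ) (h : IsLift φ s₀ v v') :
    ∃ c : ℝ, ∀ t', collapse φ s₀ t' = s₀ → ∀ p' : β → ℝ, eval p' (v' t') = c * p' t' := by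
  obtain ⟨c, hc⟩ := h.fiber
  refine ⟨c, fun t' ht' p' => ?_⟩
  obtain ⟨ι, hι, e⟩ := exists_section_apply_eq (a₀ := s₀) hφ t'
  rw [ht'] at e
  rw [← e, h.eval_section hι, hc]
  simp

theorem eval_scale (h : IsLift φ s₀ v v') {p q : α → ℝ} {x : ℝ} (hq : q s₀ = x * p s₀) :
    eval q (v s₀) = x * eval p (v s₀) := by
  obtain ⟨c, hc⟩ := h.fiber
  simp only [hc, map_mul, eval_C, eval_X, hq]
  ring

end IsLift

end Lift

namespace IsBoundedInclusion

open MvPolynomial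

variable {T : TwistedCoxeterSystem W} {T' : TwistedCoxeterSystem W'} {φ : T.S → T'.S}
  {f : W →* W'} {J : Set T.S} {s₀ : T.S}

theorem isLift_root (h : IsBoundedInclusion T T' φ f J s₀) {r : T.S} (hr : r ∈ J) :
    IsLift φ s₀ (T.root _ r) (T'.root _ (φ r)) where
  sec ι hι t := h.root_section hι hr (rename ι : _ →ₐ[ℝ] _).toRingHom t
  fiber := ⟨0, by simp [root_apply, (h.ne_of_mem hr).symm]⟩
  indep t ht p q _ := by rw [root_apply]; split_ifs <;> simp

theorem eval_bilin_root (h : IsBoundedInclusion T T' φ f J s₀) {r : T.S} (hr : r ∈ J)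
    [Fintype T.S] {v : T.S → MvPolynomial T.S ℝ} {v' : T'.S → MvPolynomial T'.S ℝ}
    (hv : IsLift φ s₀ v v') {p q : T.S → ℝ} (hpq : ∀ u ≠ s₀, q u = p u) :
    eval q (T.bilin (T.root _ r) v) = eval p (T.bilin (T.root _ r) v) := by
  rw [bilin_root, map_sum, map_sum]
  refine Finset.sum_congr rfl fun u _ => ?_
  by_cases hu : u = s₀
  · rw [hu, h.form_s₀ hr]; simp
  · rw [map_mul, map_mul, hv.indep u hu p q hpq, algebraMap_eq, eval_C, eval_C]

theorem isLift_reflect (h : IsBoundedInclusion T T' φ f J s₀) [Fintype T.S] [Fintype T'.S]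
    {r : T.S} (hr : r ∈ J) {v : T.S → MvPolynomial T.S ℝ} {v' : T'.S → MvPolynomial T'.S ℝ}
    (hv : IsLift φ s₀ v v') : IsLift φ s₀ (T.reflect r v) (T'.reflect (φ r) v') where
  sec ι hι t := h.reflect_section hι hr (rename ι) (hv.sec ι hι) t
  fiber := by
    obtain ⟨c, hc⟩ := hv.fiber
    exact ⟨c, by simp [reflect, root_apply, (h.ne_of_mem hr).symm, hc]⟩
  indep t ht p q hpq := by
    simp only [reflect, root_apply, map_sub, map_mul, hv.indep t ht p q hpq,
      h.eval_bilin_root hr hv hpq]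
    split_ifs <;> simp

end IsBoundedInclusion

end TwistedCoxeterSystem

namespace TwistedCoxeterSystem

variable {W W' : Type*} [Group W] [Group W']

open MvPolynomial

/-- The section `ι` of `collapse φ s₀` selects a coordinate of `p'` in the fibre over `s₀` which is
nonzero unless `p'` vanishes on the whole fibre. Restriction along such a section preserves
the nonvanishing of vectors and the exclusions `v ≠ w`. -/
def DetectsFiber {α β : Type*} (φ : α → β) (s₀ : α) (ι : α → β) (p' : β → ℝ) : Prop :=
  p' (ι s₀) = 0 → ∀ t', collapse φ s₀ t' = s₀ → p' t' = 0

theorem exists_detectsFiber {α β : Type*} {φ : α → β} (hφ : Function.Injective φ) (s₀ : α)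
    (p' : β → ℝ) :
    ∃ ι : α → β, Function.LeftInverse (collapse φ s₀) ι ∧ DetectsFiber φ s₀ ι p' := by
  by_cases h : ∃ t', collapse φ s₀ t' = s₀ ∧ p' t' ≠ 0
  · obtain ⟨t', ht, hp⟩ := h
    obtain ⟨ι, hι, e⟩ := exists_section_apply_eq (a₀ := s₀) hφ t'
    rw [ht] at e
    exact ⟨ι, hι, fun h0 => absurd (e ▸ h0) hp⟩
  · push Not at h
    exact ⟨φ, collapse_apply hφ, fun _ => h⟩

/-- If some coordinate of a lifted vector does not vanish, then some coordinate in the range of a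
section detecting the fibre does not vanish. -/
theorem IsLift.exists_ne_zero {α β : Type*} {φ : α → β} (hφ : Function.Injective φ) {s₀ : α}
    {v : α → MvPolynomial α ℝ} {v' : β → MvPolynomial β ℝ} (hv : IsLift φ s₀ v v') {ι : α → β}
    (hι : Function.LeftInverse (collapse φ s₀) ι) {p' : β → ℝ} (hp : DetectsFiber φ s₀ ι p')
    {t' : β} (ht : eval p' (v' t') ≠ 0) : ∃ t, eval (p' ∘ ι) (v t) ≠ 0 := by
  by_cases h : collapse φ s₀ t' = s₀
  · obtain ⟨c, hc⟩ := hv.eval_fiber hφ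
    refine ⟨s₀, ?_⟩
    rw [hc t' h] at ht
    rw [← hv.eval_section hι, hc _ (hι s₀)]
    exact mul_ne_zero (left_ne_zero_of_mul ht) fun h0 => right_ne_zero_of_mul ht (hp h0 t' h)
  · refine ⟨collapse φ s₀ t', ?_⟩
    rwa [← hv.eval_section hι, section_apply_of_ne hφ hι h, map_collapse_of_ne hφ h]

theorem IsLift.eq_iff {α β : Type*} {φ : α → β} (hφ : Function.Injective φ) {s₀ : α}
    {v w : α → MvPolynomial α ℝ} {v' w' : β → MvPolynomial β ℝ} (hv : IsLift φ s₀ v v')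
    (hw : IsLift φ s₀ w w') : v' = w' ↔ v = w := by
  constructor
  · intro h
    ext1 t
    apply rename_injective φ hφ
    rw [← hv.sec φ (collapse_apply hφ), ← hw.sec φ (collapse_apply hφ), h]
  · rintro rfl
    ext1 t'
    obtain ⟨ι, hι, e⟩ := exists_section_apply_eq (a₀ := s₀) hφ t'
    rw [← e, hv.sec ι hι, hw.sec ι hι]

/-- The constraints `C'` over the larger system express the same conditions as the constraints `C`
over the smaller one, repeated for each of the additional variables: solutions (and feasible points
of the linear program) can be transported along `collapse φ s₀` and along its sections, and
the value of `x_{s₀}` in a solution can be rescaled. -/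
structure IsConstraintLift {α β : Type*} (φ : α → β) (s₀ : α) (C : Set (BraidConstraint α))
    (C' : Set (BraidConstraint β)) : Prop where
  hold_comp : ∀ p : α → ℝ, (∀ c ∈ C, c.Holds (eval p)) →
    ∀ c ∈ C', c.Holds (eval (p ∘ collapse φ s₀))
  prog_comp : ∀ p : α → ℝ, (∀ c ∈ C, ¬ c.IsExclusion → c.Holds (eval p)) →
    ∀ c ∈ C', ¬ c.IsExclusion → c.Holds (eval (p ∘ collapse φ s₀))
  prog_sec : ∀ ι : α → β, Function.LeftInverse (collapse φ s₀) ι → ∀ p' : β → ℝ,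
    (∀ c ∈ C', ¬ c.IsExclusion → c.Holds (eval p')) →
    ∀ c ∈ C, ¬ c.IsExclusion → c.Holds (eval (p' ∘ ι))
  hold_sec : ∀ ι : α → β, Function.LeftInverse (collapse φ s₀) ι → ∀ p' : β → ℝ,
    DetectsFiber φ s₀ ι p' → (∀ c ∈ C', c.Holds (eval p')) →
    ∀ c ∈ C, c.Holds (eval (p' ∘ ι))
  scale : ∀ (p q : α → ℝ) (x : ℝ), 0 < x → q s₀ = x * p s₀ → (∀ u ≠ s₀, q u = p u) →
    (∀ c ∈ C, c.Holds (eval p)) → ∀ c ∈ C, c.Holds (eval q)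

namespace IsConstraintLift

variable {α β : Type*} {φ : α → β} {s₀ : α}

theorem union {C D : Set (BraidConstraint α)} {C' D' : Set (BraidConstraint β)}
    (h : IsConstraintLift φ s₀ C C') (k : IsConstraintLift φ s₀ D D') :
    IsConstraintLift φ s₀ (C ∪ D) (C' ∪ D') where
  hold_comp p hp c hc := hc.elim (h.hold_comp p (fun c hc => hp c (Or.inl hc)) c)
    (k.hold_comp p (fun c hc => hp c (Or.inr hc)) c)
  prog_comp p hp c hc := hc.elim (h.prog_comp p (fun c hc => hp c (Or.inl hc)) c)
    (k.prog_comp p (fun c hc => hp c (Or.inr hc)) c)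
  prog_sec ι hι p hp c hc := hc.elim (h.prog_sec ι hι p (fun c hc => hp c (Or.inl hc)) c)
    (k.prog_sec ι hι p (fun c hc => hp c (Or.inr hc)) c)
  hold_sec ι hι p hd hp c hc := hc.elim (h.hold_sec ι hι p hd (fun c hc => hp c (Or.inl hc)) c)
    (k.hold_sec ι hι p hd (fun c hc => hp c (Or.inr hc)) c)
  scale p q x hx hq hpq hp c hc := hc.elim
    (h.scale p q x hx hq hpq (fun c hc => hp c (Or.inl hc)) c)
    (k.scale p q x hx hq hpq (fun c hc => hp c (Or.inr hc)) c)

/-- Constraints other than exclusions can be compared one at a time. -/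
theorem of_pairs {C : Set (BraidConstraint α)} {C' : Set (BraidConstraint β)}
    (hC : ∀ c ∈ C, ¬ c.IsExclusion) (hC' : ∀ c ∈ C', ¬ c.IsExclusion)
    (h1 : ∀ c' ∈ C', ∃ c ∈ C, ∀ p : α → ℝ, c.Holds (eval p) →
      c'.Holds (eval (p ∘ collapse φ s₀)))
    (h2 : ∀ c ∈ C, ∀ ι : α → β, Function.LeftInverse (collapse φ s₀) ι →
      ∃ c' ∈ C', ∀ p' : β → ℝ, c'.Holds (eval p') → c.Holds (eval (p' ∘ ι)))
    (h3 : ∀ c ∈ C, ∀ (p q : α → ℝ) (x : ℝ), 0 < x → q s₀ = x * p s₀ → (∀ u ≠ s₀, q u = p u) →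
      c.Holds (eval p) → c.Holds (eval q)) :
    IsConstraintLift φ s₀ C C' where
  hold_comp p hp c' hc' := by
    obtain ⟨c, hc, h⟩ := h1 c' hc'
    exact h p (hp c hc)
  prog_comp p hp c' hc' _ := by
    obtain ⟨c, hc, h⟩ := h1 c' hc'
    exact h p (hp c hc (hC c hc))
  prog_sec ι hι p' hp c hc _ := by
    obtain ⟨c', hc', h⟩ := h2 c hc ι hι
    exact h p' (hp c' hc' (hC' c' hc'))
  hold_sec ι hι p' _ hp c hc := by
    obtain ⟨c', hc', h⟩ := h2 c hc ι hι
    exact h p' (hp c' hc')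
  scale p q x hx hq hpq hp c hc := h3 c hc p q x hx hq hpq (hp c hc)

theorem empty : IsConstraintLift φ s₀ (∅ : Set (BraidConstraint α))
    (∅ : Set (BraidConstraint β)) :=
  of_pairs (by simp) (by simp) (by simp) (by simp) (by simp)

variable {v w : α → MvPolynomial α ℝ} {v' w' : β → MvPolynomial β ℝ}

theorem range_le (hφ : Function.Injective φ) (hv : IsLift φ s₀ v v') (hw : IsLift φ s₀ w w') :
    IsConstraintLift φ s₀ (Set.range fun t => BraidConstraint.le (v t) (w t))
      (Set.range fun t => BraidConstraint.le (v' t) (w' t)) := by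
  refine of_pairs ?_ ?_ ?_ ?_ ?_
  · rintro _ ⟨t, rfl⟩; exact id
  · rintro _ ⟨t, rfl⟩; exact id
  · rintro _ ⟨t', rfl⟩
    refine ⟨_, ⟨collapse φ s₀ t', rfl⟩, fun p hp => ?_⟩
    simpa only [BraidConstraint.Holds, hv.eval_comp hφ, hw.eval_comp hφ] using hp
  · rintro _ ⟨t, rfl⟩ ι hι
    refine ⟨_, ⟨ι t, rfl⟩, fun p hp => ?_⟩
    simpa only [BraidConstraint.Holds, hv.eval_section hι, hw.eval_section hι] using hp
  · rintro _ ⟨t, rfl⟩ p q x hx hq hpq hp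
    simp only [BraidConstraint.Holds] at hp ⊢
    by_cases ht : t = s₀
    · subst ht
      rw [hv.eval_scale hq, hw.eval_scale hq]
      gcongr
    · rwa [hv.indep t ht p q hpq, hw.indep t ht p q hpq]

theorem range_eq (hφ : Function.Injective φ) (hv : IsLift φ s₀ v v') (hw : IsLift φ s₀ w w') :
    IsConstraintLift φ s₀ (Set.range fun t => BraidConstraint.eq (v t) (w t))
      (Set.range fun t => BraidConstraint.eq (v' t) (w' t)) := by
  refine of_pairs ?_ ?_ ?_ ?_ ?_
  · rintro _ ⟨t, rfl⟩; exact id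
  · rintro _ ⟨t, rfl⟩; exact id
  · rintro _ ⟨t', rfl⟩
    refine ⟨_, ⟨collapse φ s₀ t', rfl⟩, fun p hp => ?_⟩
    simpa only [BraidConstraint.Holds, hv.eval_comp hφ, hw.eval_comp hφ] using hp
  · rintro _ ⟨t, rfl⟩ ι hι
    refine ⟨_, ⟨ι t, rfl⟩, fun p hp => ?_⟩
    simpa only [BraidConstraint.Holds, hv.eval_section hι, hw.eval_section hι] using hp
  · rintro _ ⟨t, rfl⟩ p q x hx hq hpq hp
    simp only [BraidConstraint.Holds] at hp ⊢
    by_cases ht : t = s₀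
    · subst ht
      rw [hv.eval_scale hq, hw.eval_scale hq, hp]
    · rwa [hv.indep t ht p q hpq, hw.indep t ht p q hpq]

theorem singleton_ne (hφ : Function.Injective φ) (hv : IsLift φ s₀ v v')
    (hw : IsLift φ s₀ w w') :
    IsConstraintLift φ s₀ {BraidConstraint.ne v w} {BraidConstraint.ne v' w'} where
  hold_comp p hp := by
    have h := hp _ rfl
    rintro _ rfl he
    refine h (funext fun t => ?_)
    have := congrFun he (φ t)
    simpa only [hv.eval_comp hφ, hw.eval_comp hφ, collapse_apply hφ] using this
  prog_comp p _ := by rintro _ rfl h; exact absurd trivial h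
  prog_sec ι _ p' _ := by rintro _ rfl h; exact absurd trivial h
  hold_sec ι hι p' hd hp := by
    have h := hp _ rfl
    rintro _ rfl he
    obtain ⟨t', ht'⟩ := Function.ne_iff.1 h
    obtain ⟨t, ht⟩ := (hv.sub hw).exists_ne_zero hφ hι hd (t' := t')
      (by rw [map_sub]; exact sub_ne_zero.2 ht')
    rw [map_sub] at ht
    exact sub_ne_zero.1 ht (congrFun he t)
  scale p q x hx hq hpq hp := by
    have h := hp _ rfl
    rintro _ rfl he
    refine h (funext fun t => ?_)
    have := congrFun he t
    by_cases ht : t = s₀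
    · subst ht
      simp only [hv.eval_scale hq, hw.eval_scale hq] at this
      exact mul_left_cancel₀ hx.ne' this
    · simpa only [hv.indep t ht p q hpq, hw.indep t ht p q hpq] using this

end IsConstraintLift

/-! ### Lifts of braid systems -/

/-- The braid system `B'` over the larger system is the counterpart of `B`: the words and the
domains correspond under `φ`, and the vectors `σ α_u` and the constraints of `B'` are lifts of
those of `B`. -/
structure IsSystemLift {T : TwistedCoxeterSystem W} {T' : TwistedCoxeterSystem W'}
    (φ : T.S → T'.S) (J : Set T.S) (s₀ : T.S) (B : BraidSystem T) (B' : BraidSystem T') :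
    Prop where
  word₁ : B'.word₁ = B.word₁.map φ
  word₂ : B'.word₂ = B.word₂.map φ
  dom : B'.dom = φ '' B.dom
  dom_subset : B.dom ⊆ J
  lift : ∀ u ∈ B.dom, IsLift φ s₀ (B.σ u) (B'.σ (φ u))
  constraints : IsConstraintLift φ s₀ B.C B'.C
  isConstant_iff : B'.IsConstant ↔ B.IsConstant

theorem isLeast_image_iff {α β : Type*} [LinearOrder α] [LinearOrder β] {φ : α → β}
    (hφ : StrictMono φ) {D : Set α} {b : β} :
    IsLeast (φ '' D) b ↔ ∃ a, φ a = b ∧ IsLeast D a := by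
  constructor
  · rintro ⟨⟨a, ha, rfl⟩, h⟩
    exact ⟨a, rfl, ha, fun x hx => hφ.le_iff_le.1 (h ⟨x, hx, rfl⟩)⟩
  · rintro ⟨a, rfl, ha, h⟩
    refine ⟨⟨a, ha, rfl⟩, ?_⟩
    rintro _ ⟨x, hx, rfl⟩
    exact hφ.monotone (h hx)

namespace IsSystemLift

variable {T : TwistedCoxeterSystem W} {T' : TwistedCoxeterSystem W'} {φ : T.S → T'.S}
  {f : W →* W'} {J : Set T.S} {s₀ : T.S} {B : BraidSystem T} {B' : BraidSystem T'}

theorem isSolution_comp (h : IsBoundedInclusion T T' φ f J s₀)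
    (hB : IsSystemLift φ J s₀ B B') {p : T.S → ℝ} (hp : B.IsSolution (eval p)) :
    B'.IsSolution (eval (p ∘ collapse φ s₀)) := by
  refine ⟨hB.constraints.hold_comp p hp.1, ?_⟩
  rw [hB.dom]
  rintro _ ⟨u, hu, rfl⟩
  have hφ := h.injective_gen
  simp only [(hB.lift u hu).eval_comp hφ]
  refine (hp.2 u hu).imp (fun h1 => ?_) fun h1 => ?_ <;>
  · rw [Pi.lt_def] at h1 ⊢
    refine ⟨fun t' => h1.1 _, ?_⟩
    obtain ⟨t, ht⟩ := h1.2
    exact ⟨φ t, by simpa only [collapse_apply hφ, Pi.zero_apply] using ht⟩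

theorem isSolution_section (h : IsBoundedInclusion T T' φ f J s₀)
    (hB : IsSystemLift φ J s₀ B B') {ι : T.S → T'.S}
    (hι : Function.LeftInverse (collapse φ s₀) ι) {p' : T'.S → ℝ}
    (hd : DetectsFiber φ s₀ ι p') (hp : B'.IsSolution (eval p')) :
    B.IsSolution (eval (p' ∘ ι)) := by
  refine ⟨hB.constraints.hold_sec ι hι p' hd hp.1, fun u hu => ?_⟩
  have hu' : φ u ∈ B'.dom := hB.dom ▸ Set.mem_image_of_mem φ hu
  refine (hp.2 _ hu').imp (fun h1 => ?_) fun h1 => ?_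
  · refine lt_of_le_of_ne (fun t => ?_) fun he => ?_
    · have := h1.le (ι t)
      rwa [(hB.lift u hu).eval_section hι] at this
    · obtain ⟨t', ht'⟩ := Function.ne_iff.1 h1.ne
      obtain ⟨t, ht⟩ := (hB.lift u hu).exists_ne_zero h.injective_gen hι hd ht'
      exact ht (congrFun he t)
  · refine lt_of_le_of_ne (fun t => ?_) fun he => ?_
    · have := h1.le (ι t)
      rwa [(hB.lift u hu).eval_section hι] at this
    · obtain ⟨t', ht'⟩ := Function.ne_iff.1 h1.ne'
      obtain ⟨t, ht⟩ := (hB.lift u hu).exists_ne_zero h.injective_gen hι hd ht'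
      exact ht (congrFun he t).symm

theorem isSolution_scale (hB : IsSystemLift φ J s₀ B B') {p q : T.S → ℝ} {x : ℝ} (hx : 0 < x)
    (hq : q s₀ = x * p s₀) (hpq : ∀ u ≠ s₀, q u = p u) (hp : B.IsSolution (eval p)) :
    B.IsSolution (eval q) := by
  refine ⟨hB.constraints.scale p q x hx hq hpq hp.1, fun u hu => ?_⟩
  have key : ∀ t, ∃ y > 0, eval q (B.σ u t) = y * eval p (B.σ u t) := fun t => by
    by_cases ht : t = s₀
    · exact ⟨x, hx, ht ▸ (hB.lift u hu).eval_scale hq⟩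
    · exact ⟨1, one_pos, by rw [(hB.lift u hu).indep t ht p q hpq, one_mul]⟩
  choose y hy hyq using key
  refine (hp.2 u hu).imp (fun h1 => ?_) fun h1 => ?_
  · rw [Pi.lt_def] at h1 ⊢
    obtain ⟨h1, t, ht⟩ := h1
    exact ⟨fun t => (hyq t).trans_le (mul_nonpos_of_nonneg_of_nonpos (hy t).le (h1 t)),
      t, (hyq t).trans_lt (mul_neg_of_pos_of_neg (hy t) ht)⟩
  · rw [Pi.lt_def] at h1 ⊢
    obtain ⟨h1, t, ht⟩ := h1
    exact ⟨fun t => (mul_nonneg (hy t).le (h1 t)).trans_eq (hyq t).symm,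
      t, (mul_pos (hy t) ht).trans_eq (hyq t).symm⟩

theorem isValid_iff (h : IsBoundedInclusion T T' φ f J s₀) (hB : IsSystemLift φ J s₀ B B') :
    B'.IsValid ↔ B.IsValid := by
  unfold BraidSystem.IsValid
  rw [hB.word₁, hB.word₂, h.isReduced_map_iff, h.isReduced_map_iff]
  refine and_congr_right fun _ => and_congr_right fun _ => ⟨?_, ?_⟩
  · rintro ⟨ψ, hψ⟩
    rw [ringHom_eq_eval ψ] at hψ
    obtain ⟨ι, hι, hd⟩ := exists_detectsFiber h.injective_gen s₀ fun i => ψ (X i)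
    exact ⟨_, hB.isSolution_section h hι hd hψ⟩
  · rintro ⟨ψ, hψ⟩
    rw [ringHom_eq_eval ψ] at hψ
    exact ⟨_, hB.isSolution_comp h hψ⟩

/-- If there are only finitely many solutions then the variable `x_{s₀}` vanishes in all of them,
since it could be rescaled otherwise. -/
theorem apply_eq_zero_of_finite (hB : IsSystemLift φ J s₀ B B')
    (hfin : {χ | B.IsSolution χ}.Finite) {p : T.S → ℝ} (hp : B.IsSolution (eval p)) :
    p s₀ = 0 := by
  classical
  by_contra h0
  refine Set.infinite_of_injective_forall_mem (s := {χ | B.IsSolution χ})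
    (f := fun n : ℕ => eval (fun u => if u = s₀ then ((n : ℝ) + 1) * p u else p u)) ?_ ?_ hfin
  · intro m n hmn
    have := congrArg (fun g : MvPolynomial T.S ℝ →+* ℝ => g (X s₀)) hmn
    simpa [h0] using this
  · intro n
    exact hB.isSolution_scale (x := (n : ℝ) + 1) (by positivity) (by simp)
      (fun u hu => by simp [hu]) hp

theorem eq_comp_of_finite (h : IsBoundedInclusion T T' φ f J s₀) (hB : IsSystemLift φ J s₀ B B')
    (hfin : {χ | B.IsSolution χ}.Finite) {p' : T'.S → ℝ} (hp : B'.IsSolution (eval p')) :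
    B.IsSolution (eval (p' ∘ φ)) ∧ p' = (p' ∘ φ) ∘ collapse φ s₀ := by
  have hφ := h.injective_gen
  obtain ⟨ι, hι, hd⟩ := exists_detectsFiber hφ s₀ p'
  have h0 := hd (hB.apply_eq_zero_of_finite hfin (hB.isSolution_section h hι hd hp))
  refine ⟨hB.isSolution_section h (collapse_apply hφ) (fun _ => h0) hp, funext fun t' => ?_⟩
  by_cases ht : collapse φ s₀ t' = s₀
  · simp only [Function.comp_apply, ht]
    rw [h0 t' ht, h0 _ (collapse_apply hφ s₀)]
  · simp only [Function.comp_apply, map_collapse_of_ne hφ ht]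

theorem finite_iff (h : IsBoundedInclusion T T' φ f J s₀) (hB : IsSystemLift φ J s₀ B B') :
    {χ | B'.IsSolution χ}.Finite ↔ {χ | B.IsSolution χ}.Finite := by
  constructor
  · intro hfin
    refine Set.Finite.of_injOn (t := {χ | B'.IsSolution χ})
      (f := fun χ => eval ((fun i => χ (X i)) ∘ collapse φ s₀)) ?_ ?_ hfin
    · intro χ hχ
      rw [Set.mem_ofPred_eq, ringHom_eq_eval χ] at hχ
      exact hB.isSolution_comp h hχ
    · intro χ _ χ' _ he
      rw [ringHom_eq_eval χ, ringHom_eq_eval χ']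
      congr 1
      funext i
      have := congrArg (fun g : MvPolynomial T'.S ℝ →+* ℝ => g (X (φ i))) he
      simpa [collapse_apply h.injective_gen] using this
  · intro hfin
    refine Set.Finite.of_injOn (t := {χ | B.IsSolution χ})
      (f := fun χ => eval ((fun i => χ (X i)) ∘ φ)) ?_ ?_ hfin
    · intro χ hχ
      rw [Set.mem_ofPred_eq, ringHom_eq_eval χ] at hχ
      exact (hB.eq_comp_of_finite h hfin hχ).1
    · intro χ hχ χ' hχ' he
      rw [Set.mem_ofPred_eq, ringHom_eq_eval χ] at hχ
      rw [Set.mem_ofPred_eq, ringHom_eq_eval χ'] at hχ'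
      rw [ringHom_eq_eval χ, ringHom_eq_eval χ', (hB.eq_comp_of_finite h hfin hχ).2,
        (hB.eq_comp_of_finite h hfin hχ').2]
      congr 2
      funext i
      have := congrArg (fun g : MvPolynomial T.S ℝ →+* ℝ => g (X i)) he
      simpa using this

/-- Both kinds of descents are defined by infeasibility of the linear program with one additional
condition `P` on a coordinate; this is the case `P x ↔ 0 < x` or `P x ↔ 0 ≤ x`. -/
theorem exists_infeasible_iff (h : IsBoundedInclusion T T' φ f J s₀)
    (hB : IsSystemLift φ J s₀ B B') (P : ℝ → Prop) {u : T.S} (hu : u ∈ B.dom) :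
    (∃ t', ¬ ∃ ψ, B'.HoldsProgram ψ ∧ P (ψ (B'.σ (φ u) t'))) ↔
      ∃ t, ¬ ∃ ψ, B.HoldsProgram ψ ∧ P (ψ (B.σ u t)) := by
  have hφ := h.injective_gen
  constructor
  · rintro ⟨t', ht'⟩
    refine ⟨collapse φ s₀ t', fun ⟨ψ, h1, h2⟩ => ht' ?_⟩
    rw [ringHom_eq_eval ψ] at h1 h2
    rw [← (hB.lift u hu).eval_comp hφ] at h2
    exact ⟨_, hB.constraints.prog_comp _ h1, h2⟩
  · rintro ⟨t, ht⟩
    refine ⟨φ t, fun ⟨ψ, h1, h2⟩ => ht ?_⟩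
    rw [ringHom_eq_eval ψ] at h1 h2
    rw [(hB.lift u hu).eval_section (collapse_apply hφ)] at h2
    exact ⟨_, hB.constraints.prog_sec φ (collapse_apply hφ) _ h1, h2⟩

theorem conditionalDescents_eq (h : IsBoundedInclusion T T' φ f J s₀)
    (hB : IsSystemLift φ J s₀ B B') :
    B'.conditionalDescents = φ '' B.conditionalDescents := by
  ext s'
  constructor
  · rintro ⟨h1, h2⟩
    rw [hB.dom] at h1
    obtain ⟨u, hu, rfl⟩ := h1
    exact ⟨u, ⟨hu, (hB.exists_infeasible_iff h (fun x => 0 < x) hu).1 h2⟩, rfl⟩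
  · rintro ⟨u, ⟨hu, h2⟩, rfl⟩
    exact ⟨hB.dom ▸ Set.mem_image_of_mem φ hu,
      (hB.exists_infeasible_iff h (fun x => 0 < x) hu).2 h2⟩

theorem unconditionalDescents_eq (h : IsBoundedInclusion T T' φ f J s₀)
    (hB : IsSystemLift φ J s₀ B B') :
    B'.unconditionalDescents = φ '' B.unconditionalDescents := by
  ext s'
  constructor
  · rintro ⟨h1, h2⟩
    rw [hB.dom] at h1
    obtain ⟨u, hu, rfl⟩ := h1
    exact ⟨u, ⟨hu, (hB.exists_infeasible_iff h (fun x => 0 ≤ x) hu).1 h2⟩, rfl⟩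
  · rintro ⟨u, ⟨hu, h2⟩, rfl⟩
    exact ⟨hB.dom ▸ Set.mem_image_of_mem φ hu,
      (hB.exists_infeasible_iff h (fun x => 0 ≤ x) hu).2 h2⟩

end IsSystemLift

end TwistedCoxeterSystem

namespace TwistedCoxeterSystem

variable {W W' : Type*} [Group W] [Group W']

open MvPolynomial

/-! ### Redundancy -/

theorem forall_mem_altWord_iff {α : Type*} {P : α → Prop} {a b : α} {k : ℕ} (hk : k ≠ 0)
    (h1 : k = 1 → a = b) : (∀ x ∈ altWord a b k, P x) ↔ P a ∧ P b := by
  constructor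
  · intro h
    obtain ⟨k, rfl⟩ := Nat.exists_eq_succ_of_ne_zero hk
    have ha : P a := h a (by simp [altWord])
    refine ⟨ha, ?_⟩
    cases k with
    | zero => exact h1 rfl ▸ ha
    | succ k => exact h b (by simp [altWord])
  · rintro ⟨ha, hb⟩
    clear h1 hk
    induction k generalizing a b with
    | zero => simp [altWord]
    | succ k ih =>
      intro x hx
      rcases List.mem_cons.1 hx with rfl | hx
      · exact ha
      · exact ih hb ha x hx

/-- If each step of a relation between words of the larger system either comes from the smaller
system or does not involve words of the smaller system, then the same holds for the equivalence
relation it generates. -/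
theorem eqvGen_map {α β : Type*} {g : α → β} (hg : Function.Injective g) {R : α → α → Prop}
    {R' : β → β → Prop}
    (h : ∀ x y, R' x y → (∃ a b, x = g a ∧ y = g b ∧ R a b) ∨
      (x ∉ Set.range g ∧ y ∉ Set.range g)) {x y : β} (hxy : Relation.EqvGen R' x y) :
    (∃ a b, x = g a ∧ y = g b ∧ Relation.EqvGen R a b) ∨
      (x ∉ Set.range g ∧ y ∉ Set.range g) := by
  induction hxy with
  | rel x y hxy =>
    refine (h x y hxy).imp_left ?_
    rintro ⟨a, b, rfl, rfl, hab⟩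
    exact ⟨a, b, rfl, rfl, .rel _ _ hab⟩
  | refl x =>
    by_cases hx : x ∈ Set.range g
    · obtain ⟨a, rfl⟩ := hx
      exact .inl ⟨a, a, rfl, rfl, .refl a⟩
    · exact .inr ⟨hx, hx⟩
  | symm x y _ ih =>
    rcases ih with ⟨a, b, rfl, rfl, hab⟩ | ⟨hx, hy⟩
    · exact .inl ⟨b, a, rfl, rfl, .symm _ _ hab⟩
    · exact .inr ⟨hy, hx⟩
  | trans x y z _ _ ih1 ih2 =>
    rcases ih1 with ⟨a, b, rfl, rfl, hab⟩ | ⟨hx, hy⟩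
    · rcases ih2 with ⟨b', c, hb, rfl, hbc⟩ | ⟨hy, hz⟩
      · rw [← hg hb] at hbc
        exact .inl ⟨a, c, rfl, rfl, .trans _ _ _ hab hbc⟩
      · exact absurd ⟨b, rfl⟩ hy
    · rcases ih2 with ⟨b', c, rfl, rfl, hbc⟩ | ⟨hy, hz⟩
      · exact absurd ⟨b', rfl⟩ hy
      · exact .inr ⟨hx, hz⟩

theorem mem_range_map_iff {α β : Type*} {φ : α → β} {x : List β} :
    x ∈ Set.range (List.map φ) ↔ ∀ b ∈ x, b ∈ Set.range φ := by
  rw [Set.range_list_map]; rfl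

theorem exists_map_eq {α β : Type*} {φ : α → β} {x : List β} (h : ∀ b ∈ x, b ∈ Set.range φ) :
    ∃ a : List α, a.map φ = x := mem_range_map_iff.2 h

theorem IsInclusion.braidRel_map {T : TwistedCoxeterSystem W} {T' : TwistedCoxeterSystem W'}
    {φ : T.S → T'.S} {f : W →* W'} (h : IsInclusion T T' φ f) {a b : List T.S}
    (hab : T.BraidRel a b) : T'.BraidRel (a.map φ) (b.map φ) := by
  obtain ⟨s, t, p, q, hm, rfl, rfl⟩ := hab
  exact ⟨φ s, φ t, p.map φ, q.map φ, by rwa [h.m_map],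
    by simp [map_altWord, h.m_map], by simp [map_altWord, h.m_map]⟩

/-- A braid relation does not change the set of letters of a word. -/
theorem IsInclusion.braidRel_of_braidRel {T : TwistedCoxeterSystem W}
    {T' : TwistedCoxeterSystem W'} {φ : T.S → T'.S} {f : W →* W'} (h : IsInclusion T T' φ f)
    {x y : List T'.S} (hxy : T'.BraidRel x y) :
    (∃ a b, x = List.map φ a ∧ y = List.map φ b ∧ T.BraidRel a b) ∨
      (x ∉ Set.range (List.map φ) ∧ y ∉ Set.range (List.map φ)) := by
  obtain ⟨s', t', p', q', hm, rfl, rfl⟩ := hxy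
  have h1 := forall_mem_altWord_iff (P := (· ∈ Set.range φ)) hm (fun e => T'.m_eq_one_iff.1 e)
  have h2 := forall_mem_altWord_iff (P := (· ∈ Set.range φ)) (a := t') (b := s') hm
    (fun e => (T'.m_eq_one_iff.1 e).symm)
  by_cases hr : (∀ b ∈ p', b ∈ Set.range φ) ∧ (s' ∈ Set.range φ ∧ t' ∈ Set.range φ) ∧
      ∀ b ∈ q', b ∈ Set.range φ
  · left
    obtain ⟨hp, ⟨⟨s, rfl⟩, ⟨t, rfl⟩⟩, hq⟩ := hr
    obtain ⟨p, rfl⟩ := exists_map_eq hp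
    obtain ⟨q, rfl⟩ := exists_map_eq hq
    rw [h.m_map] at hm ⊢
    exact ⟨p ++ altWord s t (T.m s t) ++ q, p ++ altWord t s (T.m s t) ++ q,
      by simp [map_altWord], by simp [map_altWord], s, t, p, q, hm, rfl, rfl⟩
  · right
    simp only [mem_range_map_iff, List.forall_mem_append, h1, h2, and_assoc] at hr ⊢
    exact ⟨hr, fun h => hr ⟨h.1, h.2.2.1, h.2.1, h.2.2.2⟩⟩

theorem theta_map {T : TwistedCoxeterSystem W} {T' : TwistedCoxeterSystem W'} (φ : T.S → T'.S)
    (swap : Bool) (r s : T.S) : T'.theta swap (φ r) (φ s) = φ (T.theta swap r s) := by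
  cases swap <;> rfl

namespace IsSystemLift

variable {T : TwistedCoxeterSystem W} {T' : TwistedCoxeterSystem W'} {φ : T.S → T'.S}
  {f : W →* W'} {J : Set T.S} {s₀ : T.S} {B : BraidSystem T} {B' : BraidSystem T'}

theorem row_eq_root_iff (h : IsBoundedInclusion T T' φ f J s₀) (hB : IsSystemLift φ J s₀ B B')
    {u x : T.S} (hu : u ∈ B.dom) (hx : x ∈ J) :
    B'.σ (φ u) = T'.root _ (T'.starS (φ x)) ↔ B.σ u = T.root _ (T.starS x) := by
  rw [h.starS_map]
  exact (hB.lift u hu).eq_iff h.injective_gen (h.isLift_root (h.starS_mem x hx))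

theorem theta_mem (hB : IsSystemLift φ J s₀ B B') {r s : T.S} (hr : r ∈ B.dom) (hs : s ∈ B.dom)
    (swap : Bool) : T.theta swap r s ∈ J := by
  cases swap
  · exact hB.dom_subset hr
  · exact hB.dom_subset hs

theorem sigmaRel_map (h : IsBoundedInclusion T T' φ f J s₀) (hB : IsSystemLift φ J s₀ B B')
    {a b : List T.S} (hab : B.SigmaRel a b) : B'.SigmaRel (a.map φ) (b.map φ) := by
  obtain ⟨r, hr, s, hs, swap, h1, h2, h3, h4, t, ht, c, rfl, rfl⟩ := hab
  have hd : ∀ u ∈ B.dom, φ u ∈ B'.dom := fun u hu => hB.dom ▸ Set.mem_image_of_mem φ hu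
  refine ⟨φ r, hd r hr, φ s, hd s hs, swap, ?_, ?_, ?_, ?_, φ t, hd t ht, c.map φ, ?_, ?_⟩
  · rwa [theta_map, hB.row_eq_root_iff h hr (hB.theta_mem hr hs swap)]
  · rwa [theta_map, hB.row_eq_root_iff h hs (hB.theta_mem hs hr swap)]
  · rwa [h.m_map]
  · rwa [h.m_map, h.mTheta_map]
  · simp [map_altWord, h.mTheta_map]
  · simp [map_altWord, h.mTheta_map]

theorem sigmaRel_of_sigmaRel (h : IsBoundedInclusion T T' φ f J s₀)
    (hB : IsSystemLift φ J s₀ B B') {x y : List T'.S} (hxy : B'.SigmaRel x y) :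
    (∃ a b, x = List.map φ a ∧ y = List.map φ b ∧ B.SigmaRel a b) ∨
      (x ∉ Set.range (List.map φ) ∧ y ∉ Set.range (List.map φ)) := by
  obtain ⟨r', hr, s', hs, swap, h1, h2, h3, h4, t', ht, c', rfl, rfl⟩ := hxy
  rw [hB.dom] at hr hs ht
  obtain ⟨r, hr, rfl⟩ := hr
  obtain ⟨s, hs, rfl⟩ := hs
  obtain ⟨t, ht, rfl⟩ := ht
  rw [h.mTheta_map, ← map_altWord, ← map_altWord]
  by_cases hc : ∀ b ∈ c', b ∈ Set.range φ
  · left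
    obtain ⟨c, rfl⟩ := exists_map_eq hc
    refine ⟨altWord r s (T.mTheta swap r s) ++ t :: c, altWord s r (T.mTheta swap r s) ++ t :: c,
      by simp, by simp, r, hr, s, hs, swap, ?_, ?_, ?_, ?_, t, ht, c, rfl, rfl⟩
    · rwa [theta_map, hB.row_eq_root_iff h hr (hB.theta_mem hr hs swap)] at h1
    · rwa [theta_map, hB.row_eq_root_iff h hs (hB.theta_mem hs hr swap)] at h2
    · rwa [h.m_map] at h3
    · rwa [h.m_map, h.mTheta_map] at h4
  · right
    simp only [mem_range_map_iff, List.forall_mem_append, List.forall_mem_cons]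
    exact ⟨fun h => hc h.2.2, fun h => hc h.2.2⟩

theorem sigmaEquiv_map (h : IsBoundedInclusion T T' φ f J s₀) (hB : IsSystemLift φ J s₀ B B')
    {a b : List T.S} (hab : B.SigmaEquiv a b) : B'.SigmaEquiv (a.map φ) (b.map φ) := by
  induction hab with
  | rel a b hab => exact .rel _ _ (hab.imp h.braidRel_map (hB.sigmaRel_map h))
  | refl a => exact .refl _
  | symm a b _ ih => exact .symm _ _ ih
  | trans a b c _ _ ih1 ih2 => exact .trans _ _ _ ih1 ih2

theorem exists_of_sigmaEquiv (h : IsBoundedInclusion T T' φ f J s₀)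
    (hB : IsSystemLift φ J s₀ B B') {a : List T.S} {y : List T'.S}
    (hab : B'.SigmaEquiv (a.map φ) y) : ∃ b, y = b.map φ ∧ B.SigmaEquiv a b := by
  have hinj := List.map_injective_iff.2 h.injective_gen
  rcases eqvGen_map hinj (R := fun a b => T.BraidRel a b ∨ B.SigmaRel a b) (fun x y hxy => by
    rcases hxy with hxy | hxy
    · rcases h.braidRel_of_braidRel hxy with ⟨a, b, h1, h2, h3⟩ | h1
      · exact .inl ⟨a, b, h1, h2, .inl h3⟩
      · exact .inr h1
    · rcases hB.sigmaRel_of_sigmaRel h hxy with ⟨a, b, h1, h2, h3⟩ | h1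
      · exact .inl ⟨a, b, h1, h2, .inr h3⟩
      · exact .inr h1) hab with ⟨a', b, h1, rfl, h2⟩ | ⟨h1, -⟩
  · rw [← hinj h1] at h2
    exact ⟨b, rfl, h2⟩
  · exact absurd ⟨a, rfl⟩ h1

theorem isRedundant_iff (h : IsBoundedInclusion T T' φ f J s₀) (hB : IsSystemLift φ J s₀ B B') :
    B'.IsRedundant ↔ B.IsRedundant := by
  have hφ := h.injective_gen
  have hlast : ∀ (a : List T.S) (s' : T'.S), (a.map φ).getLast? = some s' ↔
      ∃ s, a.getLast? = some s ∧ φ s = s' := fun a s' => by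
    rw [List.getLast?_map, Option.map_eq_some_iff]
  constructor
  · rintro ⟨a', b', s', t', u', v', h1, h2, h3, h4, h5, h6, h7⟩
    rw [hB.word₁] at h1 h3
    rw [hB.word₂] at h2 h4
    obtain ⟨a, rfl, h8⟩ := hB.exists_of_sigmaEquiv h h3
    obtain ⟨b, rfl, h9⟩ := hB.exists_of_sigmaEquiv h h4
    rw [hlast] at h1 h2 h5 h6
    obtain ⟨s, h1, rfl⟩ := h1
    obtain ⟨t, h2, rfl⟩ := h2
    obtain ⟨u, h5, rfl⟩ := h5
    obtain ⟨v, h6, rfl⟩ := h6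
    rw [h.m_map, h.m_map, hφ.eq_iff] at h7
    exact ⟨a, b, s, t, u, v, h1, h2, h8, h9, h5, h6, h7⟩
  · rintro ⟨a, b, s, t, u, v, h1, h2, h3, h4, h5, h6, h7⟩
    refine ⟨a.map φ, b.map φ, φ s, φ t, φ u, φ v, ?_, ?_, ?_, ?_, (hlast _ _).2 ⟨_, h5, rfl⟩,
      (hlast _ _).2 ⟨_, h6, rfl⟩, ?_⟩
    · rw [hB.word₁, hlast]; exact ⟨_, h1, rfl⟩
    · rw [hB.word₂, hlast]; exact ⟨_, h2, rfl⟩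
    · rw [hB.word₁]; exact hB.sigmaEquiv_map h h3
    · rw [hB.word₂]; exact hB.sigmaEquiv_map h h4
    · rwa [h.m_map, h.m_map, hφ.eq_iff]

theorem isStopped_iff (h : IsBoundedInclusion T T' φ f J s₀) (hB : IsSystemLift φ J s₀ B B') :
    B'.IsStopped ↔ B.IsStopped := by
  unfold BraidSystem.IsStopped
  rw [hB.isConstant_iff, hB.isValid_iff h, hB.isRedundant_iff h]

end IsSystemLift

/-! ### The expansion tree -/

theorem not_isConstant_of_nonempty {T : TwistedCoxeterSystem W} {B : BraidSystem T}
    (h : B.C.Nonempty) : ¬ B.IsConstant := fun hc => h.ne_empty hc.2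

theorem subst_C {T : TwistedCoxeterSystem W} {B : BraidSystem T} {ψ : MvPolynomial T.S ℝ →+* ℝ}
    (hψ : B.IsSolution ψ) :
    (B.subst (C.comp ψ)).C = ∅ := by
  have hC : ∀ (χ : MvPolynomial T.S ℝ →+* ℝ) (a : ℝ), χ (C a) = a := fun χ a => by
    rw [ringHom_eq_eval χ, eval_C]
  ext c
  simp only [BraidSystem.subst, Set.mem_ofPred_eq, Set.mem_empty_iff_false, iff_false, not_and,
    not_not]
  rintro ⟨c, hc, rfl⟩ χ
  have := hψ.1 c hc
  cases c <;> simpa [BraidConstraint.Holds, BraidConstraint.map, hC] using this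

theorem subst_isConstant {T : TwistedCoxeterSystem W} {B : BraidSystem T}
    {ψ : MvPolynomial T.S ℝ →+* ℝ} (hψ : B.IsSolution ψ) : (B.subst (C.comp ψ)).IsConstant :=
  ⟨fun s _ t => ⟨ψ (B.σ s t), rfl⟩, subst_C hψ⟩

namespace IsSystemLift

variable {T : TwistedCoxeterSystem W} {T' : TwistedCoxeterSystem W'} {φ : T.S → T'.S}
  {f : W →* W'} {J : Set T.S} {s₀ : T.S} {B : BraidSystem T} {B' : BraidSystem T'}

theorem asc (h : IsBoundedInclusion T T' φ f J s₀) (hB : IsSystemLift φ J s₀ B B') {r : T.S}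
    (hr : r ∈ B.dom) : IsSystemLift φ J s₀ (B.asc r) (B'.asc (φ r)) where
  word₁ := hB.word₁
  word₂ := hB.word₂
  dom := hB.dom
  dom_subset := hB.dom_subset
  lift := hB.lift
  constraints := hB.constraints.union
    (.range_le h.injective_gen .zero (hB.lift r hr))
  isConstant_iff := iff_of_false
    (not_isConstant_of_nonempty ⟨_, .inr ⟨φ s₀, rfl⟩⟩)
    (not_isConstant_of_nonempty ⟨_, .inr ⟨s₀, rfl⟩⟩)

theorem isLift_neg_root (h : IsBoundedInclusion T T' φ f J s₀) (hB : IsSystemLift φ J s₀ B B')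
    {r : T.S} (hr : r ∈ B.dom) :
    IsLift φ s₀ (-T.root _ (T.starS r)) (-T'.root _ (T'.starS (φ r))) := by
  rw [h.starS_map]
  exact (h.isLift_root (h.starS_mem r (hB.dom_subset hr))).neg

theorem subst (h : IsBoundedInclusion T T' φ f J s₀) (hB : IsSystemLift φ J s₀ B B')
    {p : T.S → ℝ} (h0 : p s₀ = 0) (hp : B.IsSolution (eval p)) :
    IsSystemLift φ J s₀ (B.subst (C.comp (eval p)))
      (B'.subst (C.comp (eval (p ∘ collapse φ s₀)))) where
  word₁ := hB.word₁
  word₂ := hB.word₂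
  dom := hB.dom
  dom_subset := hB.dom_subset
  lift u hu := by
    refine ⟨fun ι hι t => ?_, ⟨0, ?_⟩, fun t _ q q' _ => ?_⟩
    · simp [BraidSystem.subst, (hB.lift u hu).eval_comp h.injective_gen, hι t]
    · obtain ⟨c, hc⟩ := (hB.lift u hu).fiber
      simp [BraidSystem.subst, hc, h0]
    · simp [BraidSystem.subst]
  constraints := by
    rw [subst_C hp, subst_C (hB.isSolution_comp h hp)]
    exact .empty
  isConstant_iff := iff_of_true (subst_isConstant (hB.isSolution_comp h hp)) (subst_isConstant hp)

variable [Fintype T.S] [Fintype T'.S]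

theorem isLift_leftMul (h : IsBoundedInclusion T T' φ f J s₀) (hB : IsSystemLift φ J s₀ B B')
    {r : T.S} (hr : r ∈ B.dom) {u : T.S} (hu : u ∈ B.dom) :
    IsLift φ s₀ (T.leftMul r B.σ u) (T'.leftMul (φ r) B'.σ (φ u)) := by
  unfold leftMul
  rw [h.starS_map]
  exact h.isLift_reflect (h.starS_mem r (hB.dom_subset hr)) (hB.lift u hu)

theorem isLift_conj (h : IsBoundedInclusion T T' φ f J s₀) (hB : IsSystemLift φ J s₀ B B')
    {r : T.S} (hr : r ∈ B.dom) {u : T.S} (hu : u ∈ B.dom) :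
    IsLift φ s₀ (T.conj r B.σ u) (T'.conj (φ r) B'.σ (φ u)) := by
  unfold conj
  rw [h.starS_map, h.form_map]
  exact h.isLift_reflect (h.starS_mem r (hB.dom_subset hr))
    ((hB.lift u hu).sub ((hB.lift r hr).smul _))

theorem des (h : IsBoundedInclusion T T' φ f J s₀) (hB : IsSystemLift φ J s₀ B B') {r : T.S}
    (hr : r ∈ B.dom) : IsSystemLift φ J s₀ (B.des r) (B'.des (φ r)) where
  word₁ := congrArg (List.cons (φ r)) hB.word₁
  word₂ := congrArg (List.cons (φ r)) hB.word₂
  dom := hB.dom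
  dom_subset := hB.dom_subset
  lift _ hu := hB.isLift_leftMul h hr hu
  constraints := hB.constraints.union
    (.range_eq h.injective_gen (hB.lift r hr) (hB.isLift_neg_root h hr))
  isConstant_iff := iff_of_false
    (not_isConstant_of_nonempty ⟨_, .inr ⟨φ s₀, rfl⟩⟩)
    (not_isConstant_of_nonempty ⟨_, .inr ⟨s₀, rfl⟩⟩)

theorem hatDes (h : IsBoundedInclusion T T' φ f J s₀) (hB : IsSystemLift φ J s₀ B B') {r : T.S}
    (hr : r ∈ B.dom) : IsSystemLift φ J s₀ (B.hatDes r) (B'.hatDes (φ r)) where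
  word₁ := congrArg (List.cons (φ r)) hB.word₁
  word₂ := congrArg (List.cons (φ r)) hB.word₂
  dom := hB.dom
  dom_subset := hB.dom_subset
  lift _ hu := hB.isLift_conj h hr hu
  constraints := hB.constraints.union
    ((IsConstraintLift.range_le h.injective_gen (hB.lift r hr) .zero).union
      (.singleton_ne h.injective_gen (hB.isLift_neg_root h hr) (hB.lift r hr)))
  isConstant_iff := iff_of_false
    (not_isConstant_of_nonempty ⟨_, .inr (.inr rfl)⟩)
    (not_isConstant_of_nonempty ⟨_, .inr (.inr rfl)⟩)

section Tree

variable [LinearOrder T.S] [LinearOrder T'.S]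

theorem exists_expandChild (h : IsBoundedInclusion T T' φ f J s₀) (hmono : StrictMono φ)
    (hB : IsSystemLift φ J s₀ B B') {B₂ : BraidSystem T} (hc : BraidSystem.ExpandChild B B₂) :
    ∃ B₂', BraidSystem.ExpandChild B' B₂' ∧ IsSystemLift φ J s₀ B₂ B₂' := by
  have hleaf := not_congr (hB.isStopped_iff h)
  have hfin := not_congr (hB.finite_iff h)
  have hcond := hB.conditionalDescents_eq h
  have huncond := hB.unconditionalDescents_eq h
  cases hc with
  | solve ψ h1 h2 h3 =>
    rw [ringHom_eq_eval ψ] at h3 ⊢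
    exact ⟨_, .solve B' _ (hleaf.2 h1) ((hB.finite_iff h).2 h2) (hB.isSolution_comp h h3),
      hB.subst h (hB.apply_eq_zero_of_finite h2 h3) h3⟩
  | unconditional_des s h1 h2 h3 =>
    exact ⟨_, .unconditional_des B' (φ s) (hleaf.2 h1) (hfin.2 h2)
      (huncond ▸ (isLeast_image_iff hmono).2 ⟨s, rfl, h3⟩), hB.des h h3.1.1⟩
  | unconditional_hatDes s h1 h2 h3 =>
    exact ⟨_, .unconditional_hatDes B' (φ s) (hleaf.2 h1) (hfin.2 h2)
      (huncond ▸ (isLeast_image_iff hmono).2 ⟨s, rfl, h3⟩), hB.hatDes h h3.1.1⟩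
  | conditional_asc s h1 h2 h3 h4 =>
    exact ⟨_, .conditional_asc B' (φ s) (hleaf.2 h1) (hfin.2 h2)
      (by rw [huncond, h3, Set.image_empty])
      (hcond ▸ (isLeast_image_iff hmono).2 ⟨s, rfl, h4⟩), hB.asc h h4.1.1⟩
  | conditional_des s h1 h2 h3 h4 =>
    exact ⟨_, .conditional_des B' (φ s) (hleaf.2 h1) (hfin.2 h2)
      (by rw [huncond, h3, Set.image_empty])
      (hcond ▸ (isLeast_image_iff hmono).2 ⟨s, rfl, h4⟩), hB.des h h4.1.1⟩
  | conditional_hatDes s h1 h2 h3 h4 =>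
    exact ⟨_, .conditional_hatDes B' (φ s) (hleaf.2 h1) (hfin.2 h2)
      (by rw [huncond, h3, Set.image_empty])
      (hcond ▸ (isLeast_image_iff hmono).2 ⟨s, rfl, h4⟩), hB.hatDes h h4.1.1⟩
  | loop h1 h2 h3 h4 =>
    exact ⟨_, .loop B' (hleaf.2 h1) (hfin.2 h2)
      (by rw [huncond, h3, Set.image_empty])
      (by rw [hcond, h4, Set.image_empty]), hB⟩

theorem exists_of_expandChild (h : IsBoundedInclusion T T' φ f J s₀) (hmono : StrictMono φ)
    (hB : IsSystemLift φ J s₀ B B') {B₂' : BraidSystem T'}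
    (hc : BraidSystem.ExpandChild B' B₂') :
    ∃ B₂, BraidSystem.ExpandChild B B₂ ∧ IsSystemLift φ J s₀ B₂ B₂' := by
  have hleaf := not_congr (hB.isStopped_iff h)
  have hfin := not_congr (hB.finite_iff h)
  have hcond := hB.conditionalDescents_eq h
  have huncond := hB.unconditionalDescents_eq h
  cases hc with
  | solve ψ h1 h2 h3 =>
    rw [ringHom_eq_eval ψ] at h3 ⊢
    have h2' := (hB.finite_iff h).1 h2
    obtain ⟨h4, h5⟩ := hB.eq_comp_of_finite h h2' h3
    refine ⟨_, .solve B _ (hleaf.1 h1) h2' h4, ?_⟩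
    have h6 := hB.subst h (hB.apply_eq_zero_of_finite h2' h4) h4
    rwa [← h5] at h6
  | unconditional_des s' h1 h2 h3 =>
    rw [huncond, isLeast_image_iff hmono] at h3
    obtain ⟨s, rfl, h3⟩ := h3
    exact ⟨_, .unconditional_des B s (hleaf.1 h1) (hfin.1 h2) h3, hB.des h h3.1.1⟩
  | unconditional_hatDes s' h1 h2 h3 =>
    rw [huncond, isLeast_image_iff hmono] at h3
    obtain ⟨s, rfl, h3⟩ := h3
    exact ⟨_, .unconditional_hatDes B s (hleaf.1 h1) (hfin.1 h2) h3, hB.hatDes h h3.1.1⟩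
  | conditional_asc s' h1 h2 h3 h4 =>
    rw [hcond, isLeast_image_iff hmono] at h4
    rw [huncond, Set.image_eq_empty] at h3
    obtain ⟨s, rfl, h4⟩ := h4
    exact ⟨_, .conditional_asc B s (hleaf.1 h1) (hfin.1 h2) h3 h4, hB.asc h h4.1.1⟩
  | conditional_des s' h1 h2 h3 h4 =>
    rw [hcond, isLeast_image_iff hmono] at h4
    rw [huncond, Set.image_eq_empty] at h3
    obtain ⟨s, rfl, h4⟩ := h4
    exact ⟨_, .conditional_des B s (hleaf.1 h1) (hfin.1 h2) h3 h4, hB.des h h4.1.1⟩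
  | conditional_hatDes s' h1 h2 h3 h4 =>
    rw [hcond, isLeast_image_iff hmono] at h4
    rw [huncond, Set.image_eq_empty] at h3
    obtain ⟨s, rfl, h4⟩ := h4
    exact ⟨_, .conditional_hatDes B s (hleaf.1 h1) (hfin.1 h2) h3 h4, hB.hatDes h h4.1.1⟩
  | loop h1 h2 h3 h4 =>
    rw [hcond, Set.image_eq_empty] at h4
    rw [huncond, Set.image_eq_empty] at h3
    exact ⟨_, .loop B (hleaf.1 h1) (hfin.1 h2) h3 h4, hB⟩

theorem treeFinite (h : IsBoundedInclusion T T' φ f J s₀) (hmono : StrictMono φ)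
    (hB : IsSystemLift φ J s₀ B B') (hfin : B.TreeFinite) : B'.TreeFinite := by
  unfold BraidSystem.TreeFinite at hfin ⊢
  induction hfin generalizing B' with
  | intro B _ ih =>
    refine Acc.intro _ fun B₂' hc => ?_
    obtain ⟨B₂, hc, hB₂⟩ := hB.exists_of_expandChild h hmono hc
    exact ih B₂ hc hB₂

theorem exists_isConstantLeaf (h : IsBoundedInclusion T T' φ f J s₀) (hmono : StrictMono φ)
    (hB : IsSystemLift φ J s₀ B B') {L : BraidSystem T} (hL : B.IsConstantLeaf L) :
    ∃ L', B'.IsConstantLeaf L' ∧ IsSystemLift φ J s₀ L L' := by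
  obtain ⟨h1, h2⟩ := hL
  suffices ∃ L', Relation.ReflTransGen BraidSystem.ExpandChild B' L' ∧
      IsSystemLift φ J s₀ L L' by
    obtain ⟨L', h3, h4⟩ := this
    exact ⟨L', ⟨h3, h4.isConstant_iff.2 h2⟩, h4⟩
  clear h2
  induction h1 with
  | refl => exact ⟨B', .refl, hB⟩
  | tail _ hc ih =>
    obtain ⟨L', h3, h4⟩ := ih
    obtain ⟨L₂', h5, h6⟩ := h4.exists_expandChild h hmono hc
    exact ⟨L₂', h3.tail h5, h6⟩

theorem exists_of_isConstantLeaf (h : IsBoundedInclusion T T' φ f J s₀) (hmono : StrictMono φ)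
    (hB : IsSystemLift φ J s₀ B B') {L' : BraidSystem T'} (hL : B'.IsConstantLeaf L') :
    ∃ L, B.IsConstantLeaf L ∧ IsSystemLift φ J s₀ L L' := by
  obtain ⟨h1, h2⟩ := hL
  suffices ∃ L, Relation.ReflTransGen BraidSystem.ExpandChild B L ∧
      IsSystemLift φ J s₀ L L' by
    obtain ⟨L, h3, h4⟩ := this
    exact ⟨L, ⟨h3, h4.isConstant_iff.1 h2⟩, h4⟩
  clear h2
  induction h1 with
  | refl => exact ⟨B, .refl, hB⟩
  | tail _ hc ih =>
    obtain ⟨L, h3, h4⟩ := ih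
    obtain ⟨L₂, h5, h6⟩ := h4.exists_of_expandChild h hmono hc
    exact ⟨L₂, h3.tail h5, h6⟩

end Tree

end IsSystemLift

end TwistedCoxeterSystem

namespace TwistedCoxeterSystem

variable {W W' : Type*} [Group W] [Group W']

open MvPolynomial

/-! ### Descent elimination -/

section Collapse

variable {α β : Type*} {φ : α → β} {a₀ : α}

theorem comp_collapse_injective (hφ : Function.Injective φ) {γ : Type*} :
    Function.Injective fun a : α → γ => a ∘ collapse φ a₀ := fun a b h => by
  ext x
  have := congrFun h (φ x)
  simpa [collapse_apply hφ] using this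

theorem comp_collapse_neg_iff (hφ : Function.Injective φ) (a : α → ℝ) :
    a ∘ collapse φ a₀ < 0 ↔ a < 0 := by
  have h1 : (0 : β → ℝ) = (0 : α → ℝ) ∘ collapse φ a₀ := rfl
  rw [lt_iff_le_and_ne, lt_iff_le_and_ne, h1,
    (comp_collapse_injective (γ := ℝ) hφ).ne_iff (x := a) (y := 0)]
  refine and_congr_left fun _ => ⟨fun h x => ?_, fun h x => h _⟩
  have := h (φ x)
  simpa [collapse_apply hφ] using this

end Collapse

namespace IsLift

variable {α β : Type*} {φ : α → β} {s₀ : α} {v : α → MvPolynomial α ℝ}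
  {v' : β → MvPolynomial β ℝ}

theorem eq_C_of_eq_C (hφ : Function.Injective φ) (h : IsLift φ s₀ v v') {t' : β} {a : ℝ}
    (ha : v (collapse φ s₀ t') = C a) : v' t' = C a := by
  obtain ⟨ι, hι, e⟩ := exists_section_apply_eq (a₀ := s₀) hφ t'
  rw [← e, h.sec ι hι, ha, rename_C]

theorem eq_C_of_map_eq_C (hφ : Function.Injective φ) (h : IsLift φ s₀ v v') {t : α} {a : ℝ}
    (ha : v' (φ t) = C a) : v t = C a := by
  apply rename_injective φ hφ
  rw [← h.sec φ (collapse_apply hφ), ha, rename_C]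

end IsLift

theorem dropConstraints_isConstant_iff {T : TwistedCoxeterSystem W} {B : BraidSystem T} :
    B.dropConstraints.IsConstant ↔ ∀ s ∈ B.dom, ∀ t, ∃ a : ℝ, B.σ s t = C a :=
  and_iff_left rfl

namespace IsSystemLift

variable {T : TwistedCoxeterSystem W} {T' : TwistedCoxeterSystem W'} {φ : T.S → T'.S}
  {f : W →* W'} {J : Set T.S} {s₀ : T.S} {B : BraidSystem T} {B' : BraidSystem T'}

theorem map_mem_dom (hB : IsSystemLift φ J s₀ B B') {u : T.S} (hu : u ∈ B.dom) :
    φ u ∈ B'.dom := hB.dom ▸ Set.mem_image_of_mem φ hu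

theorem forall_exists_eq_C_iff (hφ : Function.Injective φ) (hdom : B'.dom = φ '' B.dom)
    (hlift : ∀ u ∈ B.dom, IsLift φ s₀ (B.σ u) (B'.σ (φ u))) :
    (∀ s ∈ B'.dom, ∀ t, ∃ a : ℝ, B'.σ s t = C a) ↔ ∀ s ∈ B.dom, ∀ t, ∃ a : ℝ, B.σ s t = C a := by
  rw [hdom, Set.forall_mem_image]
  refine forall₂_congr fun u hu => ⟨fun h t => ?_, fun h t' => ?_⟩
  · exact (h (φ t)).imp fun a => (hlift u hu).eq_C_of_map_eq_C hφ
  · exact (h (collapse φ s₀ t')).imp fun a => (hlift u hu).eq_C_of_eq_C hφ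

theorem dropConstraints (hφ : Function.Injective φ) (hB : IsSystemLift φ J s₀ B B') :
    IsSystemLift φ J s₀ B.dropConstraints B'.dropConstraints where
  word₁ := hB.word₁
  word₂ := hB.word₂
  dom := hB.dom
  dom_subset := hB.dom_subset
  lift := hB.lift
  constraints := .empty
  isConstant_iff := by
    rw [dropConstraints_isConstant_iff, dropConstraints_isConstant_iff]
    exact forall_exists_eq_C_iff hφ hB.dom hB.lift

theorem descents_eq (hφ : Function.Injective φ) (hB : IsSystemLift φ J s₀ B B') :
    B'.descents = φ '' B.descents := by
  ext s'
  constructor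
  · rintro ⟨h1, a', h2, h3⟩
    rw [hB.dom] at h1
    obtain ⟨u, hu, rfl⟩ := h1
    have h4 : ∀ t, B.σ u t = C (a' (φ t)) := fun t => (hB.lift u hu).eq_C_of_map_eq_C hφ (h2 _)
    have h5 : a' = (a' ∘ φ) ∘ collapse φ s₀ := by
      funext t'
      apply C_injective T'.S ℝ
      rw [← h2, (hB.lift u hu).eq_C_of_eq_C hφ (h4 _)]
      rfl
    rw [h5, comp_collapse_neg_iff hφ] at h3
    exact ⟨u, ⟨hu, _, h4, h3⟩, rfl⟩
  · rintro ⟨u, ⟨hu, a, h1, h2⟩, rfl⟩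
    exact ⟨hB.map_mem_dom hu, a ∘ collapse φ s₀,
      fun t' => (hB.lift u hu).eq_C_of_eq_C hφ (h1 _), (comp_collapse_neg_iff hφ a).2 h2⟩

theorem row_eq_neg_root_iff (h : IsBoundedInclusion T T' φ f J s₀)
    (hB : IsSystemLift φ J s₀ B B') {u r : T.S} (hu : u ∈ B.dom) (hr : r ∈ B.dom) :
    B'.σ (φ u) = -T'.root _ (T'.starS (φ r)) ↔ B.σ u = -T.root _ (T.starS r) :=
  (hB.lift u hu).eq_iff h.injective_gen (hB.isLift_neg_root h hr)

variable [Fintype T.S] [Fintype T'.S] [LinearOrder T.S] [LinearOrder T'.S]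

theorem elimStep (h : IsBoundedInclusion T T' φ f J s₀) (hmono : StrictMono φ)
    (hB : IsSystemLift φ J s₀ B B') : IsSystemLift φ J s₀ B.elimStep B'.elimStep := by
  have hφ := h.injective_gen
  have hleast : ∀ r', IsLeast B'.descents r' ↔ ∃ r, φ r = r' ∧ IsLeast B.descents r := by
    intro r'
    rw [hB.descents_eq hφ, isLeast_image_iff hmono]
  unfold BraidSystem.elimStep
  by_cases hr : ∃ r, IsLeast B.descents r
  · have hr' : ∃ r', IsLeast B'.descents r' :=
      ⟨φ hr.choose, (hleast _).2 ⟨_, rfl, hr.choose_spec⟩⟩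
    have e : hr'.choose = φ hr.choose :=
      hr'.choose_spec.unique ((hleast _).2 ⟨_, rfl, hr.choose_spec⟩)
    have hd : hr.choose ∈ B.dom := hr.choose_spec.1.1
    rw [dif_pos hr, dif_pos hr', e]
    by_cases hc : B.σ hr.choose = -T.root _ (T.starS hr.choose)
    · rw [if_pos hc, if_pos ((hB.row_eq_neg_root_iff h hd hd).2 hc)]
      exact (hB.des h hd).dropConstraints hφ
    · rw [if_neg hc, if_neg (mt (hB.row_eq_neg_root_iff h hd hd).1 hc)]
      exact (hB.hatDes h hd).dropConstraints hφ
  · have hr' : ¬ ∃ r', IsLeast B'.descents r' := by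
      rintro ⟨r', hr'⟩
      obtain ⟨r, -, hr1⟩ := (hleast _).1 hr'
      exact hr ⟨r, hr1⟩
    rwa [dif_neg hr, dif_neg hr']

theorem elimSeq (h : IsBoundedInclusion T T' φ f J s₀) (hmono : StrictMono φ)
    (hB : IsSystemLift φ J s₀ B B') (i : ℕ) :
    IsSystemLift φ J s₀ (B.elimSeq i) (B'.elimSeq i) := by
  unfold BraidSystem.elimSeq
  induction i with
  | zero => exact hB
  | succ i ih =>
    rw [Function.iterate_succ_apply', Function.iterate_succ_apply']
    exact ih.elimStep h hmono

end IsSystemLift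

section Dom

variable {T : TwistedCoxeterSystem W} [Fintype T.S] [LinearOrder T.S]

theorem elimStep_dom (B : BraidSystem T) : B.elimStep.dom = B.dom := by
  unfold BraidSystem.elimStep
  split_ifs <;> rfl

theorem elimSeq_dom (B : BraidSystem T) (i : ℕ) : (B.elimSeq i).dom = B.dom := by
  unfold BraidSystem.elimSeq
  induction i with
  | zero => rfl
  | succ i ih => rw [Function.iterate_succ_apply', elimStep_dom, ih]

end Dom

namespace IsBoundedInclusion

variable {T : TwistedCoxeterSystem W} {T' : TwistedCoxeterSystem W'} {φ : T.S → T'.S}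
  {f : W →* W'} {J : Set T.S} {s₀ : T.S}

theorem neg_root_comp (h : IsBoundedInclusion T T' φ f J s₀) {r : T.S} (hr : r ∈ J) :
    -T'.root ℝ (T'.starS (φ r)) = (-T.root ℝ (T.starS r)) ∘ collapse φ s₀ := by
  funext t'
  obtain ⟨ι, hι, e⟩ := exists_section_apply_eq (a₀ := s₀) h.injective_gen t'
  have := h.root_section hι (h.starS_mem r hr) (RingHom.id ℝ) (collapse φ s₀ t')
  rw [e, RingHom.id_apply] at this
  rw [h.starS_map, Pi.neg_apply, this]
  rfl

variable [Fintype T.S] [Fintype T'.S]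

theorem reflect_comp (h : IsBoundedInclusion T T' φ f J s₀) {r : T.S} (hr : r ∈ J)
    (v : T.S → ℝ) :
    T'.reflect (φ r) (v ∘ collapse φ s₀) = T.reflect r v ∘ collapse φ s₀ := by
  funext t'
  obtain ⟨ι, hι, e⟩ := exists_section_apply_eq (a₀ := s₀) h.injective_gen t'
  have := h.reflect_section hι hr (AlgHom.id ℝ ℝ) (v := v) (v' := v ∘ collapse φ s₀)
    (fun t => by simp [hι t]) (collapse φ s₀ t')
  rwa [e] at this

theorem bullet_comp (h : IsBoundedInclusion T T' φ f J s₀) {r s : T.S} (hr : r ∈ J)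
    {l : T.S → T.S → ℝ} {l' : T'.S → T'.S → ℝ} (hlr : l' (φ r) = l r ∘ collapse φ s₀)
    (hls : l' (φ s) = l s ∘ collapse φ s₀) :
    BraidSystem.bullet l' (φ r) (φ s) = BraidSystem.bullet l r s ∘ collapse φ s₀ := by
  have hc : l' (φ r) = -T'.root ℝ (T'.starS (φ r)) ↔ l r = -T.root ℝ (T.starS r) := by
    rw [hlr, h.neg_root_comp hr]
    exact (comp_collapse_injective h.injective_gen).eq_iff
  unfold BraidSystem.bullet
  simp only [hc]
  split_ifs
  · unfold leftMul
    rw [h.starS_map, hls, h.reflect_comp (h.starS_mem r hr)]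
  · unfold conj
    rw [h.starS_map, h.form_map, ← h.reflect_comp (h.starS_mem r hr), hlr, hls]
    rfl

end IsBoundedInclusion

theorem periodicWord_map {α β : Type*} {φ : α → β} {p q : ℕ} {r : ℕ → α} {r' : ℕ → β}
    (hr : ∀ j ∈ Finset.Icc 1 p, r' j = φ (r j)) :
    (List.replicate q ((List.range p).map (fun k => r' (k + 1))).reverse).flatten =
      ((List.replicate q ((List.range p).map (fun k => r (k + 1))).reverse).flatten).map φ := by
  have : (List.range p).map (fun k => r' (k + 1)) =
      ((List.range p).map (fun k => r (k + 1))).map φ := by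
    rw [List.map_map]
    refine List.map_congr_left fun k hk => hr _ ?_
    rw [List.mem_range] at hk
    rw [Finset.mem_Icc]; omega
  rw [this, List.map_flatten, List.map_replicate, List.map_reverse]

/-- The condition on the values of a periodic descent is insensitive to repeating coordinates. -/
theorem descent_values_iff {α β : Type*} {φ : α → β} (hφ : Function.Injective φ) {a₀ : α}
    (a : ℕ → α → ℝ) (x : α → ℝ) :
    ((∀ n, a n ∘ collapse φ a₀ < 0) ∧
      ¬ (x ∘ collapse φ a₀ ∈ Set.range (fun n => a n ∘ collapse φ a₀) ∧
        Set.range (fun n => a n ∘ collapse φ a₀) ≠ {x ∘ collapse φ a₀})) ↔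
    ((∀ n, a n < 0) ∧ ¬ (x ∈ Set.range (fun n => a n) ∧ Set.range (fun n => a n) ≠ {x})) := by
  have hinj := comp_collapse_injective (a₀ := a₀) (γ := ℝ) hφ
  have h1 : Set.range (fun n => a n ∘ collapse φ a₀) =
      (fun b : α → ℝ => b ∘ collapse φ a₀) '' Set.range (fun n => a n) := by
    rw [← Set.range_comp]; rfl
  have h2 : ({x ∘ collapse φ a₀} : Set (β → ℝ)) =
      (fun b : α → ℝ => b ∘ collapse φ a₀) '' {x} := by
    rw [Set.image_singleton]
  have h3 : x ∘ collapse φ a₀ ∈ (fun b : α → ℝ => b ∘ collapse φ a₀) '' Set.range (fun n => a n) ↔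
      x ∈ Set.range (fun n => a n) := hinj.mem_set_image
  rw [h1, h2, h3, hinj.image_injective.ne_iff]
  simp only [comp_collapse_neg_iff hφ]

namespace IsSystemLift

variable {T : TwistedCoxeterSystem W} {T' : TwistedCoxeterSystem W'} {φ : T.S → T'.S}
  {f : W →* W'} {J : Set T.S} {s₀ : T.S} {B : BraidSystem T} {B' : BraidSystem T'}
  [Fintype T.S] [Fintype T'.S] [LinearOrder T.S] [LinearOrder T'.S]

theorem descentPeriodic_map (h : IsBoundedInclusion T T' φ f J s₀) (hmono : StrictMono φ)
    (hB : IsSystemLift φ J s₀ B B') {i : ℕ} (hper : B.DescentPeriodic i) :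
    B'.DescentPeriodic i := by
  have hφ := h.injective_gen
  have hseq := hB.elimSeq h hmono
  obtain ⟨p, q, r, g, l, h1, h2, h3, h4, h5, h6, h7, h8, h9, h10, h11⟩ := hper
  have hrd : ∀ j ∈ Finset.Icc 1 p, r (j + 1) ∈ B.dom := fun j hj => by
    rw [Finset.mem_Icc] at hj
    rcases hj.2.eq_or_lt with rfl | hlt
    · rw [h5]; exact h4 1 (Finset.mem_Icc.2 ⟨le_rfl, h1⟩)
    · exact h4 _ (Finset.mem_Icc.2 ⟨by omega, hlt⟩)
  obtain ⟨r', hr'⟩ : ∃ r' : ℕ → T'.S, ∀ j, r' j = φ (r j) := ⟨φ ∘ r, fun _ => rfl⟩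
  obtain ⟨l', hl, hl6⟩ : ∃ l' : ℕ → ℕ → T'.S → T'.S → ℝ,
      (∀ j n u, l' j n (φ u) = l j n u ∘ collapse φ s₀) ∧ ∀ j n s' t', l' j n s' t' =
        (g (collapse φ s₀ s') (collapse φ s₀ t') j).eval (n : ℝ) := by
    refine ⟨fun j n s' t' => l j n (collapse φ s₀ s') (collapse φ s₀ t'), fun j n u => ?_,
      fun j n s' t' => h6 _ _ _ _⟩
    funext t'
    simp only [collapse_apply hφ, Function.comp_apply]
  refine ⟨p, q, r', fun s' t' => g (collapse φ s₀ s') (collapse φ s₀ t'), l', h1, h2, h3,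
    fun j hj => hr' j ▸ hB.map_mem_dom (h4 j hj), by rw [hr', hr', h5], hl6, ?_, ?_, ?_, ?_, ?_⟩
  · rw [periodicWord_map (fun j _ => hr' j), (hseq i).word₁]
    exact h7.map φ
  · rw [periodicWord_map (fun j _ => hr' j), (hseq i).word₂]
    exact h8.map φ
  · rw [hB.dom, Set.forall_mem_image]
    intro u hu t' j hj
    obtain ⟨h12, h13⟩ := h9 u hu (collapse φ s₀ t') j hj
    refine ⟨by simpa only [collapse_apply hφ] using h12, fun n hn => ?_⟩
    rw [hl]
    exact ((hseq _).lift u (by rwa [elimSeq_dom])).eq_C_of_eq_C hφ (h13 n hn)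
  · intro j hj
    have := (descent_values_iff (a₀ := s₀) hφ (fun n => l j n (r (j + 1)))
      (-T.root ℝ (T.starS (r (j + 1))))).2 (h10 j hj)
    simp only [hr', hl]
    rwa [h.neg_root_comp (hB.dom_subset (hrd j hj))]
  · intro n
    rw [hB.dom, Set.forall_mem_image]
    intro u hu
    obtain ⟨h12, h13⟩ := h11 n u hu
    refine ⟨?_, fun j hj => ?_⟩
    · rw [hl, h12, hr']
      exact (h.bullet_comp (hB.dom_subset (h4 1 (Finset.mem_Icc.2 ⟨le_rfl, h1⟩))) (hl _ _ _)
        (hl _ _ _)).symm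
    · rw [hl, h13 j hj, hr']
      rw [Finset.mem_Icc] at hj
      exact (h.bullet_comp (hB.dom_subset (h4 j (Finset.mem_Icc.2 ⟨by omega, hj.2⟩))) (hl _ _ _)
        (hl _ _ _)).symm

theorem descentPeriodic_of_map (h : IsBoundedInclusion T T' φ f J s₀) (hmono : StrictMono φ)
    (hB : IsSystemLift φ J s₀ B B') {i : ℕ} (hper : B'.DescentPeriodic i) :
    B.DescentPeriodic i := by
  have hφ := h.injective_gen
  have hseq := hB.elimSeq h hmono
  obtain ⟨p, q, r', g', l', h1, h2, h3, h4, h5, h6, h7, h8, h9, h10, h11⟩ := hper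
  have hr : ∀ j ∈ Finset.Icc 1 p, collapse φ s₀ (r' j) ∈ B.dom ∧
      r' j = φ (collapse φ s₀ (r' j)) := fun j hj => by
    have := h4 j hj
    rw [hB.dom] at this
    obtain ⟨u, hu, e⟩ := this
    rw [← e, collapse_apply hφ]
    exact ⟨hu, rfl⟩
  have hr1 : ∀ j ∈ Finset.Icc 1 p, collapse φ s₀ (r' (j + 1)) ∈ B.dom ∧
      r' (j + 1) = φ (collapse φ s₀ (r' (j + 1))) := fun j hj => by
    rw [Finset.mem_Icc] at hj
    rcases hj.2.eq_or_lt with rfl | hlt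
    · rw [h5]; exact hr 1 (Finset.mem_Icc.2 ⟨le_rfl, h1⟩)
    · exact hr _ (Finset.mem_Icc.2 ⟨by omega, hlt⟩)
  -- coordinates in the same fibre have the same interpolating polynomial
  have hpoly : ∀ u ∈ B.dom, ∀ t', ∀ j ∈ Finset.Icc 1 p,
      g' (φ u) t' j = g' (φ u) (φ (collapse φ s₀ t')) j := fun u hu t' j hj => by
    obtain ⟨h12, h13⟩ := h9 (φ u) (hB.map_mem_dom hu) t' j hj
    obtain ⟨h14, h15⟩ := h9 (φ u) (hB.map_mem_dom hu) (φ (collapse φ s₀ t')) j hj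
    refine Polynomial.eq_of_degrees_lt_of_eval_index_eq (Finset.range q) (v := fun n : ℕ => (n : ℝ))
      (fun a _ b _ hab => Nat.cast_injective hab) (by rwa [Finset.card_range])
      (by rwa [Finset.card_range]) fun n hn => ?_
    rw [Finset.mem_range] at hn
    have hL := (hseq (i - p * q + j + n * p)).lift u (by rwa [elimSeq_dom])
    rw [← h6, ← h6]
    apply C_injective T'.S ℝ
    rw [← h13 n hn]
    exact hL.eq_C_of_eq_C hφ (hL.eq_C_of_map_eq_C hφ (h15 n hn))
  obtain ⟨l, hl0, hl⟩ : ∃ l : ℕ → ℕ → T.S → T.S → ℝ,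
      (∀ j n s t, l j n s t = l' j n (φ s) (φ t)) ∧ ∀ u ∈ B.dom, ∀ j ∈ Finset.Icc 1 p, ∀ n,
        l' j n (φ u) = l j n u ∘ collapse φ s₀ := by
    refine ⟨fun j n s t => l' j n (φ s) (φ t), fun _ _ _ _ => rfl, fun u hu j hj n => ?_⟩
    funext t'
    change l' j n (φ u) t' = l' j n (φ u) (φ (collapse φ s₀ t'))
    rw [h6, h6, hpoly u hu t' j hj]
  have hp : p ∈ Finset.Icc 1 p := Finset.mem_Icc.2 ⟨h1, le_rfl⟩
  have h1p : 1 ∈ Finset.Icc 1 p := Finset.mem_Icc.2 ⟨le_rfl, h1⟩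
  refine ⟨p, q, fun j => collapse φ s₀ (r' j), fun s t => g' (φ s) (φ t),
    l, h1, h2, h3, fun j hj => (hr j hj).1,
    congrArg _ h5, fun j n s t => (hl0 j n s t).trans (h6 j n _ _), ?_, ?_, ?_, ?_, ?_⟩
  · rw [periodicWord_map (fun j hj => (hr j hj).2), (hseq i).word₁] at h7
    exact (List.prefix_map_iff_of_injective hφ).1 h7
  · rw [periodicWord_map (fun j hj => (hr j hj).2), (hseq i).word₂] at h8
    exact (List.prefix_map_iff_of_injective hφ).1 h8
  · intro u hu t j hj
    obtain ⟨h12, h13⟩ := h9 (φ u) (hB.map_mem_dom hu) (φ t) j hj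
    refine ⟨h12, fun n hn => ?_⟩
    rw [hl0]
    exact ((hseq _).lift u (by rwa [elimSeq_dom])).eq_C_of_map_eq_C hφ (h13 n hn)
  · intro j hj
    obtain ⟨hd, e⟩ := hr1 j hj
    have := h10 j hj
    rw [e, h.neg_root_comp (hB.dom_subset hd)] at this
    simp only [hl _ hd j hj] at this
    exact (descent_values_iff hφ _ _).1 this
  · intro n u hu
    obtain ⟨h12, h13⟩ := h11 n (φ u) (hB.map_mem_dom hu)
    refine ⟨?_, fun j hj => ?_⟩
    · obtain ⟨hd, e⟩ := hr 1 h1p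
      rw [e, h.bullet_comp (hB.dom_subset hd) (hl _ hd p hp n) (hl _ hu p hp n),
        hl u hu 1 h1p] at h12
      exact comp_collapse_injective hφ h12
    · have h14 := h13 j hj
      rw [Finset.mem_Icc] at hj
      have hj0 : j ∈ Finset.Icc 1 p := Finset.mem_Icc.2 ⟨by omega, hj.2⟩
      have hj1 : j - 1 ∈ Finset.Icc 1 p := Finset.mem_Icc.2 ⟨by omega, by omega⟩
      obtain ⟨hd, e⟩ := hr j hj0
      rw [e, h.bullet_comp (hB.dom_subset hd) (hl _ hd _ hj1 _) (hl _ hu _ hj1 _),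
        hl u hu j hj0] at h14
      exact comp_collapse_injective hφ h14

theorem elimFails_iff (h : IsBoundedInclusion T T' φ f J s₀) (hmono : StrictMono φ)
    (hB : IsSystemLift φ J s₀ B B') (i : ℕ) : B'.ElimFails i ↔ B.ElimFails i := by
  have hseq := hB.elimSeq h hmono i
  unfold BraidSystem.ElimFails
  rw [hseq.isValid_iff h, hseq.isRedundant_iff h]
  exact or_congr_right (or_congr_right
    ⟨hB.descentPeriodic_of_map h hmono, hB.descentPeriodic_map h hmono⟩)

theorem elimSeq_descents_eq_empty_iff (h : IsBoundedInclusion T T' φ f J s₀)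
    (hmono : StrictMono φ) (hB : IsSystemLift φ J s₀ B B') (i : ℕ) :
    (B'.elimSeq i).descents = ∅ ↔ (B.elimSeq i).descents = ∅ := by
  rw [(hB.elimSeq h hmono i).descents_eq h.injective_gen, Set.image_eq_empty]

theorem elimTerminates_iff (h : IsBoundedInclusion T T' φ f J s₀) (hmono : StrictMono φ)
    (hB : IsSystemLift φ J s₀ B B') : B'.ElimTerminates ↔ B.ElimTerminates := by
  unfold BraidSystem.ElimTerminates
  simp only [hB.elimFails_iff h hmono, hB.elimSeq_descents_eq_empty_iff h hmono]

theorem exists_elimOutput (h : IsBoundedInclusion T T' φ f J s₀) (hmono : StrictMono φ)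
    (hB : IsSystemLift φ J s₀ B B') {B₂ : BraidSystem T} (ho : B.ElimOutput B₂) :
    ∃ B₂', B'.ElimOutput B₂' ∧ IsSystemLift φ J s₀ B₂ B₂' := by
  obtain ⟨i, h1, h2, h3, rfl⟩ := ho
  refine ⟨_, ⟨i, ?_, ?_, ?_, rfl⟩, hB.elimSeq h hmono i⟩
  · simpa only [hB.elimFails_iff h hmono, ne_eq, hB.elimSeq_descents_eq_empty_iff h hmono] using h1
  · rwa [hB.elimFails_iff h hmono]
  · rwa [hB.elimSeq_descents_eq_empty_iff h hmono]

theorem exists_of_elimOutput (h : IsBoundedInclusion T T' φ f J s₀) (hmono : StrictMono φ)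
    (hB : IsSystemLift φ J s₀ B B') {B₂' : BraidSystem T'} (ho : B'.ElimOutput B₂') :
    ∃ B₂, B.ElimOutput B₂ ∧ IsSystemLift φ J s₀ B₂ B₂' := by
  obtain ⟨i, h1, h2, h3, rfl⟩ := ho
  refine ⟨_, ⟨i, ?_, ?_, ?_, rfl⟩, hB.elimSeq h hmono i⟩
  · simpa only [hB.elimFails_iff h hmono, ne_eq, hB.elimSeq_descents_eq_empty_iff h hmono] using h1
  · rwa [hB.elimFails_iff h hmono] at h2
  · rwa [hB.elimSeq_descents_eq_empty_iff h hmono] at h3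

end IsSystemLift

end TwistedCoxeterSystem

namespace TwistedCoxeterSystem

variable {W W' : Type*} [Group W] [Group W']

open MvPolynomial

/-! ### The forest -/

theorem bilin_eq_sum (T : TwistedCoxeterSystem W) [Fintype T.S] {A : Type*} [CommRing A]
    [Algebra ℝ A] (v w : T.S → A) :
    T.bilin v w = ∑ t, w t * T.bilin (T.root A t) v := by
  unfold bilin
  rw [Finset.sum_comm]
  refine Finset.sum_congr rfl fun t _ => ?_
  have := T.bilin_root t v
  unfold bilin at this
  rw [this, Finset.mul_sum]
  refine Finset.sum_congr rfl fun s _ => ?_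
  rw [form, form, m_comm]
  ring

namespace IsBoundedInclusion

variable {T : TwistedCoxeterSystem W} {T' : TwistedCoxeterSystem W'} {φ : T.S → T'.S}
  {f : W →* W'} {J : Set T.S} {s₀ : T.S}

theorem bdry_map (h : IsBoundedInclusion T T' φ f J s₀) {K : Set T.S} (hK : K ⊆ J) :
    T'.bdry Set.univ (φ '' K) = φ '' T.bdry Set.univ K := by
  have hφ := h.injective_gen
  ext s'
  constructor
  · rintro ⟨-, h1, _, ⟨t, ht, rfl⟩, h2⟩
    have h3 : ∃ s, φ s = s' := by
      by_cases hs : s' ∈ φ '' J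
      · obtain ⟨s, -, rfl⟩ := hs; exact ⟨s, rfl⟩
      · have : s' ∈ T'.bdry Set.univ (φ '' J) := ⟨trivial, hs, φ t, ⟨t, hK ht, rfl⟩, h2⟩
        rw [h.bdry_image] at this
        obtain ⟨s, -, rfl⟩ := this; exact ⟨s, rfl⟩
    obtain ⟨s, rfl⟩ := h3
    rw [h.m_map] at h2
    exact ⟨s, ⟨trivial, fun hs => h1 ⟨s, hs, rfl⟩, t, ht, h2⟩, rfl⟩
  · rintro ⟨s, ⟨-, h1, t, ht, h2⟩, rfl⟩
    refine ⟨trivial, ?_, φ t, ⟨t, ht, rfl⟩, by rwa [h.m_map]⟩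
    rwa [hφ.mem_set_image]

theorem eval_bilin [Fintype T.S] (h : IsBoundedInclusion T T' φ f J s₀)
    {v w : T.S → MvPolynomial T.S ℝ}
    {v' w' : T'.S → MvPolynomial T'.S ℝ} (hv : IsLift φ s₀ v v') (hw : IsLift φ s₀ w w')
    (hJ : ∀ t ∉ J, w t = 0) {p q : T.S → ℝ} (hpq : ∀ u ≠ s₀, q u = p u) :
    eval q (T.bilin v w) = eval p (T.bilin v w) := by
  rw [bilin_eq_sum, map_sum, map_sum]
  refine Finset.sum_congr rfl fun t _ => ?_
  by_cases ht : t ∈ J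
  · rw [map_mul, map_mul, h.eval_bilin_root ht hv hpq, hw.indep t (h.ne_of_mem ht) p q hpq]
  · rw [hJ t ht, zero_mul, map_zero, map_zero]

variable [Fintype T.S] [Fintype T'.S]

theorem bilin_section (h : IsBoundedInclusion T T' φ f J s₀) {v w : T.S → MvPolynomial T.S ℝ}
    {v' w' : T'.S → MvPolynomial T'.S ℝ} (hv : IsLift φ s₀ v v') (hw : IsLift φ s₀ w w')
    (hJ : ∀ t ∉ J, w t = 0) {ι : T.S → T'.S} (hι : Function.LeftInverse (collapse φ s₀) ι) :
    T'.bilin v' w' = rename ι (T.bilin v w) := by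
  have hφ := h.injective_gen
  rw [bilin_eq_sum, bilin_eq_sum, map_sum]
  symm
  refine Fintype.sum_of_injective ι hι.injective _ _ (fun t' ht' => ?_) fun t => ?_
  · obtain ⟨ι', hι', e⟩ := exists_section_apply_eq (a₀ := s₀) hφ t'
    have h0 := collapse_eq_of_notMem_range hφ hι ht'
    rw [← e, hw.sec ι' hι', h0, hJ s₀ h.notMem, map_zero, zero_mul]
  · rw [map_mul, ← hw.sec ι hι]
    by_cases ht : t ∈ J
    · rw [section_apply_of_ne hφ hι (h.ne_of_mem ht),
        h.bilin_root_section hι ht (rename ι) (hv.sec ι hι)]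
    · rw [hw.sec ι hι, hJ t ht, map_zero, zero_mul, zero_mul]

end IsBoundedInclusion

namespace IsSystemLift

variable {T : TwistedCoxeterSystem W} {T' : TwistedCoxeterSystem W'} {φ : T.S → T'.S}
  {f : W →* W'} {J : Set T.S} {s₀ : T.S} {B : BraidSystem T} {B' : BraidSystem T'}

theorem isTrivial_iff (h : IsBoundedInclusion T T' φ f J s₀) (hB : IsSystemLift φ J s₀ B B') :
    B'.IsTrivial ↔ B.IsTrivial := by
  unfold BraidSystem.IsTrivial
  rw [hB.word₁, hB.word₂, h.exists_mem_invWords_map_iff, hB.dom, Set.forall_mem_image]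
  exact and_congr_right fun _ => forall₂_congr fun u hu =>
    (hB.lift u hu).eq_iff h.injective_gen (h.isLift_root (hB.dom_subset hu))

variable [Fintype T.S] [Fintype T'.S]

/-- Passing from `B` to `B ↓ r` is compatible with lifts. As `σ` maps into `V_J`, the constraints
do not involve the variables of the fibre over `s₀`, except for their nonnegativity; and there is
no constraint on the determinant, as the domain does not contain `s₀`. -/
theorem down (h : IsBoundedInclusion T T' φ f J s₀) (hB : IsSystemLift φ J s₀ B B')
    (hJ : ∀ u ∈ B.dom, ∀ v ∉ J, B.σ u v = 0) {r : T.S} (hr : r ∈ J) (hr' : r ∉ B.dom) :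
    IsSystemLift φ J s₀ (B.down r) (B'.down (φ r)) := by
  have hφ := h.injective_gen
  have hrow : IsLift φ s₀ (B.downMap r r) (B'.downMap (φ r) (φ r)) := by
    simp only [BraidSystem.downMap, if_true]
    exact IsLift.coordinates.neg
  have hne : ∀ u ∈ B.dom, u ≠ r := fun u hu e => hr' (e ▸ hu)
  have hold : ∀ u ∈ B.dom, B.downMap r u = B.σ u := fun u hu => by
    simp [BraidSystem.downMap, hne u hu]
  have hold' : ∀ u ∈ B.dom, B'.downMap (φ r) (φ u) = B'.σ (φ u) := fun u hu => by
    simp [BraidSystem.downMap, hφ.eq_iff, hne u hu]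
  have hdom : insert (φ r) B'.dom = φ '' insert r B.dom := by rw [hB.dom, Set.image_insert_eq]
  refine ⟨hB.word₁, hB.word₂, hdom, Set.insert_subset hr hB.dom_subset, ?_, ?_, iff_of_false
    (not_isConstant_of_nonempty ⟨_, .inl (.inl ⟨φ s₀, rfl⟩)⟩)
    (not_isConstant_of_nonempty ⟨_, .inl (.inl ⟨s₀, rfl⟩)⟩)⟩
  · intro u hu
    rcases hu with rfl | hu
    · exact hrow
    · change IsLift φ s₀ (B.downMap r u) (B'.downMap (φ r) (φ u))
      rw [hold u hu, hold' u hu]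
      exact hB.lift u hu
  · refine ((IsConstraintLift.range_le hφ .zero .coordinates).union ?_).union ?_
    · refine .of_pairs ?_ ?_ ?_ ?_ ?_
      · rintro _ ⟨s, -, rfl⟩; exact id
      · rintro _ ⟨s, -, rfl⟩; exact id
      · rintro _ ⟨s', hs', rfl⟩
        rw [hB.dom] at hs'
        obtain ⟨s, hs, rfl⟩ := hs'
        refine ⟨_, ⟨s, hs, rfl⟩, fun p hp => ?_⟩
        simp only [BraidConstraint.Holds, eval_C, hold s hs, hold' s hs] at hp ⊢
        rw [h.bilin_section hrow (hB.lift s hs) (hJ s hs) (collapse_apply hφ), eval_rename,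
          h.form_map, Function.comp_assoc,
          show collapse φ s₀ ∘ φ = id from funext (collapse_apply hφ), Function.comp_id, hp]
      · rintro _ ⟨s, hs, rfl⟩ ι hι
        refine ⟨_, ⟨φ s, hB.map_mem_dom hs, rfl⟩, fun p hp => ?_⟩
        simp only [BraidConstraint.Holds, eval_C, hold s hs, hold' s hs] at hp ⊢
        rw [h.bilin_section hrow (hB.lift s hs) (hJ s hs) hι, eval_rename, h.form_map] at hp
        exact hp
      · rintro _ ⟨s, hs, rfl⟩ p q x _ _ hpq hp
        simp only [BraidConstraint.Holds, eval_C, hold s hs] at hp ⊢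
        rwa [h.eval_bilin hrow (hB.lift s hs) (hJ s hs) hpq]
    · have hns : s₀ ∉ insert r B.dom := by
        rintro (e | hs)
        · exact h.ne_of_mem hr e.symm
        · exact h.notMem (hB.dom_subset hs)
      have h1 : ¬ insert r B.dom = Set.univ := fun e => hns (e ▸ trivial)
      have h2 : ¬ insert (φ r) B'.dom = Set.univ := fun e => by
        rw [hdom] at e
        have : φ s₀ ∈ φ '' insert r B.dom := e ▸ trivial
        rw [hφ.mem_set_image] at this
        exact hns this
      simp only [h1, h2, false_and]
      exact .empty

variable [LinearOrder T.S] [LinearOrder T'.S]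

theorem exists_forestChild (h : IsBoundedInclusion T T' φ f J s₀) (hmono : StrictMono φ)
    (hB : IsSystemLift φ J s₀ B B') (hb : T.bdry Set.univ B.dom ⊆ J)
    (hJ : ∀ u ∈ B.dom, ∀ v ∉ J, B.σ u v = 0) {B₂ : BraidSystem T} (hc : B.ForestChild B₂) :
    ∃ B₂', B'.ForestChild B₂' ∧ IsSystemLift φ J s₀ B₂ B₂' := by
  obtain ⟨r, hr, L, hL, ho⟩ := hc
  obtain ⟨L', hL', hLL⟩ := (hB.down h hJ (hb hr) hr.2.1).exists_isConstantLeaf h hmono hL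
  obtain ⟨B₂', ho', hB₂⟩ := hLL.exists_elimOutput h hmono ho
  refine ⟨B₂', ⟨φ r, ?_, L', hL', ho'⟩, hB₂⟩
  rw [hB.dom, h.bdry_map hB.dom_subset]
  exact ⟨r, hr, rfl⟩

theorem exists_of_forestChild (h : IsBoundedInclusion T T' φ f J s₀) (hmono : StrictMono φ)
    (hB : IsSystemLift φ J s₀ B B') (hb : T.bdry Set.univ B.dom ⊆ J)
    (hJ : ∀ u ∈ B.dom, ∀ v ∉ J, B.σ u v = 0) {B₂' : BraidSystem T'} (hc : B'.ForestChild B₂') :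
    ∃ B₂, B.ForestChild B₂ ∧ IsSystemLift φ J s₀ B₂ B₂' := by
  obtain ⟨r', hr', L', hL', ho'⟩ := hc
  rw [hB.dom, h.bdry_map hB.dom_subset] at hr'
  obtain ⟨r, hr, rfl⟩ := hr'
  obtain ⟨L, hL, hLL⟩ := (hB.down h hJ (hb hr) hr.2.1).exists_of_isConstantLeaf h hmono hL'
  obtain ⟨B₂, ho, hB₂⟩ := hLL.exists_of_elimOutput h hmono ho'
  exact ⟨B₂, ⟨r, hr, L, hL, ho⟩, hB₂⟩

end IsSystemLift

section Forest

variable {T : TwistedCoxeterSystem W} {T' : TwistedCoxeterSystem W'} {φ : T.S → T'.S}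
  {f : W →* W'} {J : Set T.S} {s₀ : T.S}

theorem isSystemLift_rootSystem (h : IsBoundedInclusion T T' φ f J s₀) {s t : T.S} (hs : s ∈ J)
    (ht : t ∈ J) (swap : Bool) :
    IsSystemLift φ J s₀ (T.rootSystem swap s t) (T'.rootSystem swap (φ s) (φ t)) := by
  have hφ := h.injective_gen
  have hdom : ({φ s, φ t} : Set T'.S) = φ '' {s, t} := by rw [Set.image_pair]
  have hlift : ∀ u ∈ ({s, t} : Set T.S), IsLift φ s₀ ((T.rootSystem swap s t).σ u)
      ((T'.rootSystem swap (φ s) (φ t)).σ (φ u)) := by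
    intro u _
    have hθ : ∀ x ∈ J, ∀ y ∈ J, T.theta swap x y ∈ J := fun x hx y hy => by
      cases swap
      · exact hx
      · exact hy
    simp only [rootSystem, theta_map, h.starS_map]
    by_cases h1 : u = s
    · rw [if_pos h1, if_pos (congrArg φ h1)]
      exact h.isLift_root (h.starS_mem _ (hθ s hs t ht))
    · rw [if_neg h1, if_neg (hφ.ne h1)]
      by_cases h2 : u = t
      · rw [if_pos h2, if_pos (congrArg φ h2)]
        exact h.isLift_root (h.starS_mem _ (hθ t ht s hs))
      · rw [if_neg h2, if_neg (hφ.ne h2)]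
        exact .zero
  refine ⟨?_, ?_, hdom, ?_, hlift, .empty, ?_⟩
  · simp [rootSystem, List.map_reverse, map_altWord, h.mTheta_map]
  · simp [rootSystem, List.map_reverse, map_altWord, h.mTheta_map]
  · rintro u (rfl | rfl)
    · exact hs
    · exact ht
  · exact and_congr (IsSystemLift.forall_exists_eq_C_iff hφ hdom hlift) (iff_of_true rfl rfl)

variable [Fintype T.S] [Fintype T'.S] [LinearOrder T.S] [LinearOrder T'.S]

theorem exists_forestVertex (h : IsBoundedInclusion T T' φ f J s₀) (hmono : StrictMono φ)
    {s t : T.S} (hpar : T.IsParabolicConfiguration J s t) {B : BraidSystem T}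
    (hB : B ∈ T.forestVertices s t) :
    ∃ B' ∈ T'.forestVertices (φ s) (φ t), IsSystemLift φ J s₀ B B' := by
  obtain ⟨swap, hB⟩ := hB
  have hroot := (hpar.2.2 _ ⟨swap, .refl⟩).1
  have hs : s ∈ J := hroot (.inr (.inl rfl))
  have ht : t ∈ J := hroot (.inr (.inr rfl))
  induction hB with
  | refl => exact ⟨_, ⟨swap, .refl⟩, isSystemLift_rootSystem h hs ht swap⟩
  | @tail B B₂ hB hc ih =>
    obtain ⟨B', ⟨swap', hB'⟩, hlift⟩ := ih
    obtain ⟨h1, h2⟩ := hpar.2.2 B ⟨swap, hB⟩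
    obtain ⟨B₂', h3, h4⟩ := hlift.exists_forestChild h hmono
      (Set.subset_union_left.trans h1) h2 hc
    exact ⟨B₂', ⟨swap', hB'.tail h3⟩, h4⟩

theorem exists_of_forestVertex (h : IsBoundedInclusion T T' φ f J s₀) (hmono : StrictMono φ)
    {s t : T.S} (hpar : T.IsParabolicConfiguration J s t) {B' : BraidSystem T'}
    (hB : B' ∈ T'.forestVertices (φ s) (φ t)) :
    ∃ B ∈ T.forestVertices s t, IsSystemLift φ J s₀ B B' := by
  obtain ⟨swap, hB⟩ := hB
  have hroot := (hpar.2.2 _ ⟨swap, .refl⟩).1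
  have hs : s ∈ J := hroot (.inr (.inl rfl))
  have ht : t ∈ J := hroot (.inr (.inr rfl))
  induction hB with
  | refl => exact ⟨_, ⟨swap, .refl⟩, isSystemLift_rootSystem h hs ht swap⟩
  | tail _ hc ih =>
    obtain ⟨B, ⟨swap', hB⟩, hlift⟩ := ih
    obtain ⟨h1, h2⟩ := hpar.2.2 B ⟨swap', hB⟩
    obtain ⟨B₂, h3, h4⟩ := hlift.exists_of_forestChild h hmono
      (Set.subset_union_left.trans h1) h2 hc
    exact ⟨B₂, ⟨swap', hB.tail h3⟩, h4⟩

theorem forestExists_map (h : IsBoundedInclusion T T' φ f J s₀) (hmono : StrictMono φ)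
    {s t : T.S} (hpar : T.IsParabolicConfiguration J s t) : T'.ForestExists (φ s) (φ t) := by
  refine ⟨by rw [h.m_map]; exact hpar.2.1.1, fun B' hB' r' hr' => ?_⟩
  obtain ⟨B, hB, hlift⟩ := exists_of_forestVertex h hmono hpar hB'
  rw [hlift.dom, h.bdry_map hlift.dom_subset] at hr'
  obtain ⟨r, hr, rfl⟩ := hr'
  obtain ⟨h1, h2⟩ := hpar.2.2 B hB
  obtain ⟨h3, h4⟩ := hpar.2.1.2 B hB r hr
  have hdown := hlift.down h h2 (h1 (.inl hr)) hr.2.1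
  refine ⟨hdown.treeFinite h hmono h3, fun L' hL' => ?_⟩
  obtain ⟨L, hL, hLL⟩ := hdown.exists_of_isConstantLeaf h hmono hL'
  exact (hLL.elimTerminates_iff h hmono).2 (h4 L hL)

theorem isParabolicConfiguration_map (h : IsBoundedInclusion T T' φ f J s₀)
    (hmono : StrictMono φ) {s t : T.S} (hpar : T.IsParabolicConfiguration J s t) :
    T'.IsParabolicConfiguration (φ '' J) (φ s) (φ t) := by
  have hφ := h.injective_gen
  refine ⟨⟨?_, ?_⟩, forestExists_map h hmono hpar, fun B' hB' => ?_⟩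
  · rw [Set.image_image]
    simp only [h.starS_map]
    rw [← Set.image_image φ T.starS, hpar.1.1]
  · rw [h.bdry_image, ← Set.image_union]
    intro e
    have : φ s₀ ∈ φ '' (T.bdry Set.univ J ∪ J) := e ▸ trivial
    rw [hφ.mem_set_image] at this
    exact this.elim h.notMem_bdry h.notMem
  · obtain ⟨B, hB, hlift⟩ := exists_of_forestVertex h hmono hpar hB'
    obtain ⟨h1, h2⟩ := hpar.2.2 B hB
    rw [hlift.dom, h.bdry_map hlift.dom_subset, ← Set.image_union, Set.forall_mem_image]
    refine ⟨Set.image_mono h1, fun u hu v' hv' => ?_⟩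
    have hv : collapse φ s₀ v' ∉ J := fun hv =>
      hv' ⟨_, hv, map_collapse_of_ne hφ (h.ne_of_mem hv)⟩
    simpa using (hlift.lift u hu).eq_C_of_eq_C hφ (a := 0) (by simpa using h2 u hu _ hv)

end Forest

/-! ### The induced relations -/

/-- The two words of `B` arise from `a` and `b` by prepending the same word. -/
def ExtendsWords {T : TwistedCoxeterSystem W} (a b : List T.S) (B : BraidSystem T) : Prop :=
  ∃ p : List T.S, B.word₁ = p ++ a ∧ B.word₂ = p ++ b

section Words

variable {T : TwistedCoxeterSystem W} [Fintype T.S] {a b : List T.S} {B B₂ : BraidSystem T}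

theorem ExtendsWords.des (h : ExtendsWords a b B) (r : T.S) : ExtendsWords a b (B.des r) := by
  obtain ⟨p, h1, h2⟩ := h
  exact ⟨r :: p, congrArg (List.cons r) h1, congrArg (List.cons r) h2⟩

theorem ExtendsWords.hatDes (h : ExtendsWords a b B) (r : T.S) :
    ExtendsWords a b (B.hatDes r) := by
  obtain ⟨p, h1, h2⟩ := h
  exact ⟨r :: p, congrArg (List.cons r) h1, congrArg (List.cons r) h2⟩

variable [LinearOrder T.S]

theorem ExtendsWords.expandChild (h : ExtendsWords a b B) (hc : BraidSystem.ExpandChild B B₂) :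
    ExtendsWords a b B₂ := by
  cases hc with
  | solve => exact h
  | unconditional_des s => exact h.des s
  | unconditional_hatDes s => exact h.hatDes s
  | conditional_asc => exact h
  | conditional_des s => exact h.des s
  | conditional_hatDes s => exact h.hatDes s
  | loop => exact h

theorem ExtendsWords.elimStep (h : ExtendsWords a b B) : ExtendsWords a b B.elimStep := by
  unfold BraidSystem.elimStep
  split_ifs
  · exact h.des _
  · exact h.hatDes _
  · exact h

theorem ExtendsWords.forestChild (h : ExtendsWords a b B) (hc : B.ForestChild B₂) :
    ExtendsWords a b B₂ := by
  obtain ⟨r, -, L, ⟨hL, -⟩, i, -, -, -, rfl⟩ := hc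
  have h1 : ExtendsWords a b L := by
    induction hL with
    | refl => exact h
    | tail _ hc ih => exact ih.expandChild hc
  unfold BraidSystem.elimSeq
  induction i with
  | zero => exact h1
  | succ i ih => rw [Function.iterate_succ_apply']; exact ih.elimStep

theorem exists_extendsWords {s t : T.S} (hB : B ∈ T.forestVertices s t) :
    ∃ swap, ExtendsWords (altWord s t (T.mTheta swap s t)).reverse
      (altWord t s (T.mTheta swap s t)).reverse B := by
  obtain ⟨swap, hB⟩ := hB
  refine ⟨swap, ?_⟩
  induction hB with
  | refl => exact ⟨[], rfl, rfl⟩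
  | tail _ hc ih => exact ih.forestChild hc

theorem inducedRelations_subset {s t : T.S} (hst : s ≠ t) (hm : T.m s t ≠ 0) :
    T.inducedRelations s t ⊆ T.genHalfBraidRelations := by
  rintro _ ⟨B, hB, ⟨htriv, -⟩, rfl⟩
  obtain ⟨swap, p, h1, h2⟩ := exists_extendsWords hB
  rw [h1, h2] at htriv ⊢
  rw [reverse_altWord, reverse_altWord] at htriv ⊢
  have hn := T.mTheta_pos hm swap
  split_ifs at htriv ⊢
  · exact ⟨t, s, p, _, hst.symm, hn, htriv, rfl⟩
  · exact ⟨s, t, p, _, hst, hn, htriv, rfl⟩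

end Words

theorem headRelation_eq_iff {α : Type*} {a b c d : List α} :
    headRelation a b = headRelation c d ↔ (a = c ∧ b = d) ∨ (a = d ∧ b = c) := by
  constructor
  · intro h
    have h1 : headRelation c d a b := h ▸ ⟨[], by simp⟩
    have h2 : headRelation a b c d := h ▸ ⟨[], by simp⟩
    obtain ⟨x, hx⟩ := h1
    obtain ⟨y, hy⟩ := h2
    -- comparing lengths, the two words `x` and `y` have to be empty
    have hx0 : x = [] := by
      rw [← List.length_eq_zero_iff]
      rcases hx with ⟨h3, h4⟩ | ⟨h3, h4⟩ <;> rcases hy with ⟨h5, h6⟩ | ⟨h5, h6⟩ <;>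
      · have e1 := congrArg List.length h3
        have e2 := congrArg List.length h4
        have e3 := congrArg List.length h5
        have e4 := congrArg List.length h6
        simp only [List.length_append] at e1 e2 e3 e4
        omega
    simpa [hx0] using hx
  · rintro (⟨rfl, rfl⟩ | ⟨rfl, rfl⟩)
    · rfl
    · funext x y
      unfold headRelation
      exact propext (exists_congr fun _ => or_comm)

theorem headRelation_map_eq_iff {α β : Type*} {φ : α → β} (hφ : Function.Injective φ)
    {a b c d : List α} :
    headRelation (a.map φ) (b.map φ) = headRelation (c.map φ) (d.map φ) ↔
      headRelation a b = headRelation c d := by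
  have hinj := List.map_injective_iff.2 hφ
  simp only [headRelation_eq_iff, hinj.eq_iff]

section Relations

variable {T : TwistedCoxeterSystem W} {T' : TwistedCoxeterSystem W'} {φ : T.S → T'.S}
  {f : W →* W'} {J : Set T.S} {s₀ : T.S}
  [Fintype T.S] [Fintype T'.S] [LinearOrder T.S] [LinearOrder T'.S]

theorem exists_inducedRelations_equiv (h : IsBoundedInclusion T T' φ f J s₀)
    (hmono : StrictMono φ) {s t : T.S} (hpar : T.IsParabolicConfiguration J s t) :
    ∃ F : T.inducedRelations s t ≃ T'.inducedRelations (φ s) (φ t),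
      ∀ (a b : List T.S) (hab : headRelation a b ∈ T.inducedRelations s t),
        (F ⟨headRelation a b, hab⟩ : List T'.S → List T'.S → Prop) =
          headRelation (a.map φ) (b.map φ) := by
  have hφ := h.injective_gen
  have key : ∀ ρ : T.inducedRelations s t, ∃ ρ' : T'.inducedRelations (φ s) (φ t),
      ∀ a b : List T.S, ρ.1 = headRelation a b → ρ'.1 = headRelation (a.map φ) (b.map φ) := by
    rintro ⟨_, B, hB, htriv, rfl⟩
    obtain ⟨B', hB', hlift⟩ := exists_forestVertex h hmono hpar hB
    refine ⟨⟨_, B', hB', (hlift.isTrivial_iff h).2 htriv, rfl⟩, fun a b hab => ?_⟩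
    rw [← headRelation_map_eq_iff hφ] at hab
    rw [← hab, ← hlift.word₁, ← hlift.word₂]
  choose F hF using key
  have hex : ∀ ρ : T.inducedRelations s t, ∃ a b, ρ.1 = headRelation a b := by
    rintro ⟨_, B, -, -, rfl⟩
    exact ⟨_, _, rfl⟩
  refine ⟨Equiv.ofBijective F ⟨fun ρ₁ ρ₂ e => ?_, ?_⟩, fun a b hab => hF _ a b rfl⟩
  · obtain ⟨a, b, h1⟩ := hex ρ₁
    obtain ⟨c, d, h2⟩ := hex ρ₂
    have h3 := congrArg Subtype.val e
    rw [hF ρ₁ a b h1, hF ρ₂ c d h2, headRelation_map_eq_iff hφ, ← h1, ← h2] at h3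
    exact Subtype.ext h3
  · rintro ⟨_, B', hB', htriv, rfl⟩
    obtain ⟨B, hB, hlift⟩ := exists_of_forestVertex h hmono hpar hB'
    refine ⟨⟨headRelation B.word₁ B.word₂, B, hB, (hlift.isTrivial_iff h).1 htriv, rfl⟩,
      Subtype.ext ?_⟩
    exact (hF _ _ _ rfl).trans (congrArg₂ headRelation hlift.word₁ hlift.word₂).symm

end Relations

theorem IsBoundedEmbedding.exists_isBoundedInclusion {T : TwistedCoxeterSystem W}
    {T' : TwistedCoxeterSystem W'} {φ : T.S → T'.S} {f : W →* W'} {J : Set T.S}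
    (hf : IsBoundedEmbedding T T' J f) (hfφ : ∀ x : T.S, f x = φ x) :
    ∃ s₀, IsBoundedInclusion T T' φ f J s₀ := by
  obtain ⟨hJ, ⟨-, hstar⟩, hinj, hb⟩ := hf
  obtain ⟨s₀, hs₀⟩ := (Set.ne_univ_iff_exists_notMem _).1 hJ.2
  have himage : ∀ K : Set T.S, {x : T'.S | ∃ s ∈ K, f s = x} = φ '' K := fun K => by
    ext x
    simp only [Set.mem_ofPred_eq, Set.mem_image, hfφ, Subtype.coe_inj]
  have himage' : ∀ K : Set T.S,
      {x : W' | ∃ s ∈ K, f s = x} = Subtype.val '' (φ '' K) := fun K => by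
    ext x
    simp only [Set.mem_ofPred_eq, Set.mem_image, hfφ, exists_exists_and_eq_and]
  rw [himage, himage', Subtype.val_injective.image_injective.eq_iff] at hb
  exact ⟨s₀, ⟨hinj, hfφ, hstar⟩, fun r hr => hJ.1 ▸ Set.mem_image_of_mem T.starS hr,
    fun hs => hs₀ (.inr hs), fun hs => hs₀ (.inl hs), hb⟩

end TwistedCoxeterSystem

theorem mainTheorem5 {W W' : Type*} [Group W] [Group W']
    (T : TwistedCoxeterSystem W) (T' : TwistedCoxeterSystem W')
    [Fintype T.S] [LinearOrder T.S] [Fintype T'.S] [LinearOrder T'.S]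
    (φ : T.S → T'.S) (hmono : Monotone φ) (J : Set T.S) (s t : T.S) (hst : s ≠ t)
    (hpar : T.IsParabolicConfiguration J s t)
    (hemb : ∃ f : W →* W', TwistedCoxeterSystem.IsBoundedEmbedding T T' J f ∧
      ∀ x : T.S, f x = φ x) :
    T.ForestExists s t ∧ T'.ForestExists (φ s) (φ t) ∧
    T.inducedRelations s t ⊆ T.genHalfBraidRelations ∧
    T'.inducedRelations (φ s) (φ t) ⊆ T'.genHalfBraidRelations ∧
    (∃ F : T.inducedRelations s t ≃ T'.inducedRelations (φ s) (φ t),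
      ∀ (a b : List T.S) (h : headRelation a b ∈ T.inducedRelations s t),
        (F ⟨headRelation a b, h⟩ : List T'.S → List T'.S → Prop) =
          headRelation (a.map φ) (b.map φ)) ∧
    T'.IsParabolicConfiguration (φ '' J) (φ s) (φ t) := by
  obtain ⟨f, hf, hfφ⟩ := hemb
  obtain ⟨s₀, h⟩ := hf.exists_isBoundedInclusion hfφ
  have hφ := h.injective_gen
  have hstrict := hmono.strictMono_of_injective hφ
  have hex := TwistedCoxeterSystem.forestExists_map h hstrict hpar
  exact ⟨hpar.2.1, hex, TwistedCoxeterSystem.inducedRelations_subset hst hpar.2.1.1,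
    TwistedCoxeterSystem.inducedRelations_subset (hφ.ne hst) hex.1,
    TwistedCoxeterSystem.exists_inducedRelations_equiv h hstrict hpar,
    TwistedCoxeterSystem.isParabolicConfiguration_map h hstrict hpar⟩
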